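/- Let $n\ge 2$, $k\ge 1$. Matrices carry the Euclidean (Frobenius) norm $|\cdot|$ and $\operatorname{dist}$ is the corresponding distance. *Wells.* Let $U_1,\dots,U_k\in\mathbb R^{n\times n}$ be symmetric and positive definite, put $K=\bigcup_{j=1}^k SO(n)U_j$, and let $d>0$ be such that $\operatorname{dist}(SO(n)U_i,SO(n)U_j)\ge d$ for all $i\ne j$. Let $B\subset S^{n-1}$ be the set of all unit vectors $b'$ for which there are $i\neq j$, $Q\in SO(n)$ and $a\in\mathbb R^n\setminus\{0\}$ with $U_i-QU_j=a\otimes b'$. Fix $\delta_0>0$ and call $b\in S^{n-1}$ *incompatible* if $|b\cdot b'|\le 1-\delta_0$ for all $b'\in B$. *Triangulations.* Let $\Omega\subset\mathbb R^n$ be bounded and open. For every integer $m\ge1$ let $\mathcal T_m$ be a (face-to-face) triangulation of $\Omega$ by closed $n$-simplices ("tetrahedra"), whose interiors lie in $\Omega$ and which cover $\Omega$, such that, with constants $\tilde c_1,\tilde c_2>0$ independent of $m$, every $T\in\mathcal T_m$ has in-radius at least $\tilde c_1m^{-1}$ and diameter at most $\tilde c_2m^{-1}$. Assume that the unit normals of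 all $(n-1)$-dimensional interfaces between two tetrahedra of $\mathcal T_m$ are incompatible, for all $m\geq 1$ (with the same $\delta_0$). *Deformations and energy.* Let $h:\mathbb R^{n\times n}\to[0,\infty)$, $c_1>0$ and a set $D\subset\mathbb R^{n\times n}$ (for instance $D=\{M:\det M>0\}$) be such that $c_1\operatorname{dist}^2(M,K)\le h(M)$ for all $M\in D$. For $m\ge1$ let $u_m\in W^{1,\infty}(\Omega,\mathbb R^n)$ be such that $\nabla u_m$ is constant on each $T\in\mathcal T_m$, with value $\nabla u_m|_T\in D$, and assume that $$E_m(u_m)=\int_\Omega h(\nabla u_m)\,dx\le C m^{-1}\qquad\text{for all } m\geq 1,$$ with a constant $C$ that does not depend on $m$. Then there is a number $\bar d>0$ such that for all $i\ne j$, all $Q\in SO(n)$, all incompatible $b\in S^{n-1}$ and all orthonormal bases $\tau_1,\dots,\tau_{n-1}$ of $b^\perp$ $$\max_{1\le l\le n-1}|(U_i-QU_j)\tau_l|\ \ge\ \bar d .\tag{1}$$ Moreover, for every $\bar d>0$ with (1), put $c_0=\min\{\bar d,d\}$, and let $$\Omega_{j,m}=\bigcup\Big\{T\in\mathcal T_m:\operatorname{dist}(\nabla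 u_m|_T,SO(n)U_j)\le\tfrac{c_0}{100}\Big\}\quad (1\le j\le k),\qquad \Omega_{b,m}=\bigcup\Big\{T\in\mathcal T_m:\operatorname{dist}(\nabla u_m|_T,K)>\tfrac{c_0}{100}\Big\}.$$ Then: 1. the perimeters of $\Omega_{1,m},\dots,\Omega_{k,m}$ and $\Omega_{b,m}$ in $\Omega$ are bounded uniformly in $m\ge1$; 2. $\chi_{\Omega_{b,m}}\to0$ in $L^1(\Omega)$ as $m\to\infty$; 3. there are Caccioppoli sets (measurable sets of finite perimeter in $\Omega$) $\Omega_1,\dots,\Omega_k\subset\Omega$ with $\Omega=\bigcup_{j=1}^k\Omega_j$ and a subsequence, the same for all $j$, along which $\chi_{\Omega_{j,m}}\to\chi_{\Omega_j}$ in $L^1(\Omega)$ for every $j\in\{1,\dots,k\}$. -/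

import Mathlib

open MeasureTheory Filter Topology
open scoped NNReal ENNReal ContDiff

-- The norm and the distance on matrices are the Frobenius (Euclidean) ones.
attribute [local instance] Matrix.frobeniusNormedAddCommGroup

noncomputable section

namespace SpinArgument

/-- `ℝⁿ` with the Euclidean norm. -/
abbrev E (n : ℕ) : Type := EuclideanSpace ℝ (Fin n)

/-- Real `n × n` matrices. -/
abbrev Mat (n : ℕ) : Type := Matrix (Fin n) (Fin n) ℝ

variable {n : ℕ}

/-! ### Wells -/

/-- The well `SO(n) U`. -/
def well (U : Mat n) : Set (Mat n) :=
  {M | ∃ Q ∈ Matrix.specialOrthogonalGroup (Fin n) ℝ, M = Q * U}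

/-- The union `K` of the wells `SO(n) U_j`. -/
def wells {k : ℕ} (U : Fin k → Mat n) : Set (Mat n) := ⋃ j, well (U j)

/-- Different wells have mutual distance at least `d`. -/
def WellsSeparated {k : ℕ} (U : Fin k → Mat n) (d : ℝ) : Prop :=
  ∀ i j, i ≠ j → ∀ A ∈ well (U i), ∀ B ∈ well (U j), d ≤ dist A B

/-- The unit vector `b` is the normal of a rank-one connection `U_i - Q U_j = a ⊗ b` between
two different wells, with `Q ∈ SO(n)` and `a ≠ 0`. -/
def IsRankOneNormal {k : ℕ} (U : Fin k → Mat n) (b : E n) : Prop :=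
  ‖b‖ = 1 ∧ ∃ i j, i ≠ j ∧ ∃ Q ∈ Matrix.specialOrthogonalGroup (Fin n) ℝ, ∃ a : E n,
    a ≠ 0 ∧ U i - Q * U j = Matrix.vecMulVec a b

/-- `|b · b'| ≤ 1 - δ₀` for all normals `b'` of rank-one connections between the wells. -/
def IsIncompatibleNormal {k : ℕ} (U : Fin k → Mat n) (δ₀ : ℝ) (b : E n) : Prop :=
  ∀ b' : E n, IsRankOneNormal U b' → |inner ℝ b b'| ≤ 1 - δ₀

/-- `dbar` is a lower bound, over all pairs of different wells, all rotations `Q`, all unit vectors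
`b` that are incompatible with the rank-one connections, and all orthonormal bases
`τ_1, …, τ_{n-1}` of the hyperplane orthogonal to `b`, for `max_l |(U_i - Q U_j) τ_l|`. -/
def HasTangentialGap {k : ℕ} (U : Fin k → Mat n) (δ₀ dbar : ℝ) : Prop :=
  ∀ i j, i ≠ j → ∀ Q ∈ Matrix.specialOrthogonalGroup (Fin n) ℝ,
    ∀ b : E n, ‖b‖ = 1 → IsIncompatibleNormal U δ₀ b →
    ∀ τ : Fin (n - 1) → E n, Orthonormal ℝ τ → (∀ l, inner ℝ (τ l) b = 0) →
    ∃ l, dbar ≤ ‖Matrix.toEuclideanLin (U i - Q * U j) (τ l)‖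

/-! ### Triangulations -/

/-- The (vertex sets of the) tetrahedra of a simplicial complex: its `n`-dimensional simplices.
The closed tetrahedron with vertex set `s` is `convexHull ℝ s`. -/
def tets (T : Geometry.SimplicialComplex ℝ (E n)) : Set (Finset (E n)) :=
  {s ∈ T.faces | s.card = n + 1}

/-- `T` is a triangulation of the open set `Ω`: the (open) tetrahedra lie in `Ω`, and the
(closed) tetrahedra cover `Ω`. -/
structure IsTriangulation (T : Geometry.SimplicialComplex ℝ (E n)) (Ω : Set (E n)) : Prop where
  subset : ∀ s ∈ tets T, interior (convexHull ℝ (s : Set (E n))) ⊆ Ω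
  cover : Ω ⊆ ⋃ s ∈ tets T, convexHull ℝ (s : Set (E n))

/-- The in-radius of a set: the supremum of the radii of the balls contained in it. -/
def inradius (A : Set (E n)) : ℝ := sSup {r | ∃ x, Metric.closedBall x r ⊆ A}

/-- In-radius and diameter of all tetrahedra lie between `c / m` and `C / m`. -/
def IsNondegenerate (T : Geometry.SimplicialComplex ℝ (E n)) (c C : ℝ) (m : ℕ) : Prop :=
  ∀ s ∈ tets T, c / m ≤ inradius (convexHull ℝ (s : Set (E n))) ∧
    inradius (convexHull ℝ (s : Set (E n))) ≤ Metric.diam (convexHull ℝ (s : Set (E n))) ∧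
    Metric.diam (convexHull ℝ (s : Set (E n))) ≤ C / m

/-- `b` is a unit normal of an `(n-1)`-dimensional interface of `T`, that is, of an
`(n-1)`-dimensional face (with vertex set `f`) shared by two different tetrahedra. -/
def IsInterfaceNormal (T : Geometry.SimplicialComplex ℝ (E n)) (b : E n) : Prop :=
  ‖b‖ = 1 ∧ ∃ s ∈ tets T, ∃ t ∈ tets T, s ≠ t ∧ ∃ f : Finset (E n),
    f ⊆ s ∧ f ⊆ t ∧ f.card = n ∧ ∀ x ∈ f, ∀ y ∈ f, inner ℝ (x - y) b = 0

/-! ### Deformations -/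

/-- The `j`-th partial derivative. -/
def partialDeriv (j : Fin n) (φ : E n → ℝ) (x : E n) : ℝ :=
  fderiv ℝ φ x (EuclideanSpace.single j 1)

/-- `G` is the weak gradient of `u : Ω → ℝⁿ`, `G_{ij} = ∂_j u_i`, for essentially bounded
`u` and `G`. In other words, `u ∈ W^{1,∞}(Ω, ℝⁿ)` and `∇u = G`. -/
structure IsW1InftyWithGradient (Ω : Set (E n)) (u : E n → E n) (G : E n → Mat n) : Prop where
  memLp : MemLp u ∞ (volume.restrict Ω)
  memLp_grad : ∀ i j, MemLp (fun x => G x i j) ∞ (volume.restrict Ω)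
  weak : ∀ φ : E n → ℝ, ContDiff ℝ ∞ φ → HasCompactSupport φ → tsupport φ ⊆ Ω → ∀ i j,
    ∫ x in Ω, u x i * partialDeriv j φ x = - ∫ x in Ω, G x i j * φ x

/-- The gradient field `G` is constant, equal to `M`, on the tetrahedron with vertex set `s`
(up to a null set). -/
def HasGradientOn (G : E n → Mat n) (s : Finset (E n)) (M : Mat n) : Prop :=
  ∀ᵐ x ∂(volume.restrict (convexHull ℝ (s : Set (E n)))), G x = M

/-- `u`, with weak gradient `G`, is an admissible deformation: it belongs to `W^{1,∞}(Ω, ℝⁿ)`, its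
gradient is constant on each tetrahedron of `T`, and the gradient takes values in `D` (for
orientation preserving deformations, `D` is the set of matrices of positive determinant). -/
structure IsAdmissible (Ω : Set (E n)) (T : Geometry.SimplicialComplex ℝ (E n)) (D : Set (Mat n))
    (u : E n → E n) (G : E n → Mat n) : Prop where
  sobolev : IsW1InftyWithGradient Ω u G
  piecewise : ∀ s ∈ tets T, ∃ M ∈ D, HasGradientOn G s M

/-- The energy `∫_Ω h(∇u) dx`, as a function of the gradient field. -/
def energy (Ω : Set (E n)) (h : Mat n → ℝ≥0) (G : E n → Mat n) : ℝ≥0∞ :=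
  ∫⁻ x in Ω, (h (G x) : ℝ≥0∞)

/-- The union of the tetrahedra on which the gradient has distance at most `r` from the
well `SO(n) U`. -/
def wellRegion (T : Geometry.SimplicialComplex ℝ (E n)) (G : E n → Mat n) (U : Mat n) (r : ℝ) :
    Set (E n) :=
  ⋃ s ∈ {s ∈ tets T | ∃ M, HasGradientOn G s M ∧ Metric.infDist M (well U) ≤ r},
    convexHull ℝ (s : Set (E n))

/-- The union of the bad tetrahedra, on which the gradient has distance more than `r` from the
union of all wells. -/
def badRegion {k : ℕ} (T : Geometry.SimplicialComplex ℝ (E n)) (G : E n → Mat n)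
    (U : Fin k → Mat n) (r : ℝ) : Set (E n) :=
  ⋃ s ∈ {s ∈ tets T | ∃ M, HasGradientOn G s M ∧ r < Metric.infDist M (wells U)},
    convexHull ℝ (s : Set (E n))

/-! ### Sets of finite perimeter -/

/-- The divergence of a vector field. -/
def divergence (φ : E n → E n) (x : E n) : ℝ :=
  ∑ i, (fderiv ℝ φ x (EuclideanSpace.single i 1)) i

/-- The perimeter `Per(A; Ω) = |Dχ_A|(Ω)` of `A` in the open set `Ω`: the supremum of
`∫_A div φ` over all `φ ∈ C¹_c(Ω, ℝⁿ)` with `|φ| ≤ 1`. -/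
def perimeter (Ω A : Set (E n)) : ℝ≥0∞ :=
  ⨆ φ ∈ {φ : E n → E n | ContDiff ℝ 1 φ ∧ HasCompactSupport φ ∧ tsupport φ ⊆ Ω ∧ ∀ x, ‖φ x‖ ≤ 1},
    ENNReal.ofReal (∫ x in A, divergence φ x)

/-- `A ⊆ Ω` is a Caccioppoli set in `Ω`: it is measurable and has finite perimeter in `Ω`. -/
structure IsCaccioppoli (Ω A : Set (E n)) : Prop where
  subset : A ⊆ Ω
  measurableSet : MeasurableSet A
  perimeter_lt_top : perimeter Ω A < ⊤

/-- The characteristic function of a set. -/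
def charFun (A : Set (E n)) : E n → ℝ := A.indicator (fun _ => 1)

end SpinArgument

end

/-!
If two neighbouring tetrahedra have gradients close to different wells `SO(n) U_i` and `SO(n) U_j`,
then Hadamard's jump condition makes `U_i - Q U_j` almost vanish on the tangent space of their
common facet, for some rotation `Q`. The normal of the facet is incompatible, so the tangential gap
forbids this. The gap itself follows by compactness (`exists_hasTangentialGap`): a zero of
`max_l |(U_i - Q U_j) τ_l|` would be a rank-one connection whose normal is its own incompatible
vector. Hence every interface of a region `Ω_{j,m}` inside `Ω` is a facet of a bad tetrahedron. Bad
tetrahedra carry an energy density bounded from below, so their total volume is `O(1 / m)`, and as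
their in-radii are at least of order `1 / m`, their total surface is bounded.

The proof measures surface by translations rather than by facets. A set `A` satisfies the
translation bound (`HasTranslationBound`) if, for every `h`, membership in `A` changes between
`x - h` and `x` along a segment in `Ω` only for `x` in a set of measure `P |h|`.

* For the regions (`hasTranslationBound_regions`): a segment in `Ω` that avoids the bad tetrahedra
  and the `(n - 2)`-dimensional skeleton is covered by the regions `Ω_{j,m}`, which are closed, and
  disjoint along the segment by `not_adjacent`; being connected, the segment stays in one of them.
  So, up to a null set, a change occurs only in a shell of thickness `|h|` around a bad tetrahedron
  `B`. If `B` contains a ball of radius `r`, then the thickening of `B` is contained in the dilation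
  of `B` by the factor `1 + |h| / r`, so the shell has volume at most of order `(|h| / r) |B|`
  (`volume_shell_le`). With `r` of order `1 / m` and a sum of the `|B|` of order `1 / m`, the powers
  of `m` cancel.
* The translation bound controls difference quotients of the characteristic function and so the
  perimeter (`HasTranslationBound.perimeter_le`).
* It also gives compactness in `L¹(Ω)` (`exists_subseq_limit_set`): along a subsequence all local
  averages converge, by weak compactness in `L²`, and the translation bound makes the
  characteristic functions uniformly close to their averages over small balls.

The jump condition (`IsW1InftyWithGradient.tangential_jump`) is read off from the weak form of
`∂_l G_{ij} = ∂_j G_{il}`, tested against a bump function that decreases radially around a point of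
the facet. That two tetrahedra sharing a facet lie on its two sides comes from their barycentric
coordinates (`exists_facet_normal`).
-/

namespace SpinArgument

/-! ### The tangential gap -/

section Gap

variable {n k : ℕ}

/-- The Frobenius norm dominates the operator norm. -/
lemma norm_toEuclideanLin_le (A : Mat n) (x : E n) :
    ‖Matrix.toEuclideanLin A x‖ ≤ ‖A‖ * ‖x‖ := by
  have h := Matrix.frobenius_norm_mul A (Matrix.replicateCol Unit x.ofLp)
  rw [← Matrix.replicateCol_mulVec, Matrix.frobenius_norm_replicateCol,
    Matrix.frobenius_norm_replicateCol] at h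
  exact h

lemma norm_toEuclideanLin_rotation {Q : Mat n}
    (hQ : Q ∈ Matrix.specialOrthogonalGroup (Fin n) ℝ) (A : Mat n) (x : E n) :
    ‖Matrix.toEuclideanLin (Q * A) x‖ = ‖Matrix.toEuclideanLin A x‖ := by
  have hQ' : star Q * Q = 1 := (Matrix.mem_unitaryGroup_iff'.1
    (Matrix.mem_specialOrthogonalGroup_iff.1 hQ).1)
  have key : ∀ y : E n, ‖Matrix.toEuclideanLin Q y‖ ^ 2 = ‖y‖ ^ 2 := by
    intro y
    rw [← real_inner_self_eq_norm_sq, ← real_inner_self_eq_norm_sq]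
    have h1 := LinearMap.adjoint_inner_right (Matrix.toEuclideanLin Q) y (Matrix.toEuclideanLin Q y)
    rw [← h1, ← Matrix.toEuclideanLin_conjTranspose_eq_adjoint]
    have : (Matrix.toEuclideanLin Q.conjTranspose) ((Matrix.toEuclideanLin Q) y) = y := by
      rw [← Matrix.star_eq_conjTranspose]
      simp [Matrix.toLpLin_apply, Matrix.mulVec_mulVec, hQ']
    rw [this]
  have h2 : Matrix.toEuclideanLin (Q * A) x
      = Matrix.toEuclideanLin Q (Matrix.toEuclideanLin A x) := by
    simp [Matrix.toLpLin_apply, Matrix.mulVec_mulVec]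
  rw [h2]
  exact (sq_eq_sq₀ (norm_nonneg _) (norm_nonneg _)).1 (key _)

lemma isCompact_specialOrthogonalGroup :
    IsCompact {Q : Mat n | Q ∈ Matrix.specialOrthogonalGroup (Fin n) ℝ} := by
  have hc : IsCompact (Set.univ.pi fun _ : Fin n => Set.univ.pi fun _ : Fin n =>
      Set.Icc (-1 : ℝ) 1) :=
    isCompact_univ_pi fun _ => isCompact_univ_pi fun _ => isCompact_Icc
  refine hc.of_isClosed_subset ?_ ?_
  · have : {Q : Mat n | Q ∈ Matrix.specialOrthogonalGroup (Fin n) ℝ}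
        = {Q : Mat n | Q * star Q = 1} ∩ {Q : Mat n | Q.det = 1} := by
      ext Q
      simp [Matrix.mem_specialOrthogonalGroup_iff, Matrix.mem_unitaryGroup_iff]
    rw [this]
    refine IsClosed.inter (isClosed_eq ?_ continuous_const) (isClosed_eq ?_ continuous_const)
    · exact continuous_id.matrix_mul (continuous_star (R := Matrix (Fin n) (Fin n) ℝ))
    · exact continuous_id.matrix_det
  · intro Q hQ i _ j _
    have := entry_norm_bound_of_unitary
      (Matrix.mem_specialOrthogonalGroup_iff.1 hQ).1 i j
    rwa [Real.norm_eq_abs, abs_le] at this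

/-- A matrix that vanishes on the hyperplane orthogonal to the unit vector `b` is `a ⊗ b`. -/
lemma eq_vecMulVec_of_tangential_zero {A : Mat n} {b : E n} (hb : ‖b‖ = 1)
    (hA : ∀ τ : E n, inner ℝ τ b = 0 → Matrix.toEuclideanLin A τ = 0) :
    A = Matrix.vecMulVec (Matrix.toEuclideanLin A b) b := by
  have key : ∀ x : E n, Matrix.toEuclideanLin A x
      = (inner ℝ x b) • Matrix.toEuclideanLin A b := by
    intro x
    have h0 := hA (x - (inner ℝ x b) • b) (by
      rw [inner_sub_left, inner_smul_left, real_inner_self_eq_norm_sq, hb]; simp)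
    rwa [map_sub, map_smul, sub_eq_zero] at h0
  ext i j
  have h1 := congrArg (fun v : E n => v i) (key (EuclideanSpace.single j 1))
  simp [Matrix.toLpLin_apply, EuclideanSpace.inner_single_left] at h1
  simp [Matrix.vecMulVec_apply, Matrix.toLpLin_apply, h1, mul_comm]

/-- An orthonormal family of `n - 1` vectors orthogonal to the unit vector `b` spans the hyperplane
orthogonal to `b`. -/
lemma tangential_zero_of_orthonormal {A : Mat n} {b : E n} (hb : ‖b‖ = 1)
    {τ : Fin (n - 1) → E n} (hτ : Orthonormal ℝ τ) (hτb : ∀ l, inner ℝ (τ l) b = 0)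
    (hA : ∀ l, Matrix.toEuclideanLin A (τ l) = 0) (v : E n) (hv : inner ℝ v b = 0) :
    Matrix.toEuclideanLin A v = 0 := by
  have hb0 : b ≠ 0 := by rintro rfl; simp at hb
  have hn : Module.finrank ℝ (ℝ ∙ b)ᗮ = n - 1 := by
    have := Submodule.finrank_add_finrank_orthogonal (ℝ ∙ b)
    rw [finrank_span_singleton hb0, finrank_euclideanSpace_fin] at this
    omega
  have hsub : Submodule.span ℝ (Set.range τ) ≤ (ℝ ∙ b)ᗮ := by
    rw [Submodule.span_le]
    rintro _ ⟨l, rfl⟩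
    exact Submodule.mem_orthogonal_singleton_iff_inner_left.2 (hτb l)
  have hspan : Submodule.span ℝ (Set.range τ) = (ℝ ∙ b)ᗮ := by
    refine Submodule.eq_of_le_of_finrank_eq hsub ?_
    rw [finrank_span_eq_card hτ.linearIndependent, hn, Fintype.card_fin]
  have hv' : v ∈ Submodule.span ℝ (Set.range τ) := by
    rw [hspan]; exact Submodule.mem_orthogonal_singleton_iff_inner_left.2 hv
  have hker : Submodule.span ℝ (Set.range τ) ≤ LinearMap.ker (Matrix.toEuclideanLin A) := by
    rw [Submodule.span_le]
    rintro _ ⟨l, rfl⟩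
    exact hA l
  exact hker hv'

/-- The tangential gap for a fixed pair of wells: otherwise, by compactness, an incompatible unit
vector would be the normal of a rank-one connection. -/
lemma exists_gap_pair {U : Fin k → Mat n} {d : ℝ} (hd : 0 < d)
    (hsep : WellsSeparated U d) {δ₀ : ℝ} (hδ₀ : 0 < δ₀) {i j : Fin k} (hij : i ≠ j) :
    ∃ r : ℝ, 0 < r ∧ ∀ Q ∈ Matrix.specialOrthogonalGroup (Fin n) ℝ,
      ∀ b : E n, ‖b‖ = 1 → IsIncompatibleNormal U δ₀ b →
      ∀ τ : Fin (n - 1) → E n, Orthonormal ℝ τ → (∀ l, inner ℝ (τ l) b = 0) →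
      ∃ l, r ≤ ‖Matrix.toEuclideanLin (U i - Q * U j) (τ l)‖ := by
  let X := Mat n × E n × (Fin (n - 1) → E n)
  let S : Set X := {p | p.1 ∈ Matrix.specialOrthogonalGroup (Fin n) ℝ ∧ ‖p.2.1‖ = 1 ∧
    IsIncompatibleNormal U δ₀ p.2.1 ∧ Orthonormal ℝ p.2.2 ∧ ∀ l, inner ℝ (p.2.2 l) p.2.1 = 0}
  let f : X → ℝ := fun p => ∑ l, ‖Matrix.toEuclideanLin (U i - p.1 * U j) (p.2.2 l)‖
  have hS : IsCompact S := by
    have hbig : IsCompact ({Q : Mat n | Q ∈ Matrix.specialOrthogonalGroup (Fin n) ℝ} ×ˢ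
        (Metric.closedBall (0 : E n) 1 ×ˢ
          (Set.univ.pi fun _ : Fin (n - 1) => Metric.closedBall (0 : E n) 1))) :=
      isCompact_specialOrthogonalGroup.prod ((isCompact_closedBall _ _).prod
        (isCompact_univ_pi fun _ => isCompact_closedBall _ _))
    have hcl : IsClosed {p : Mat n × E n × (Fin (n - 1) → E n) | ‖p.2.1‖ = 1 ∧
        IsIncompatibleNormal U δ₀ p.2.1 ∧ Orthonormal ℝ p.2.2 ∧
        ∀ l, inner ℝ (p.2.2 l) p.2.1 = 0} := by
      have e1 : IsClosed {p : Mat n × E n × (Fin (n - 1) → E n) | ‖p.2.1‖ = 1} :=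
        isClosed_eq (by fun_prop) continuous_const
      have e2 : IsClosed {p : Mat n × E n × (Fin (n - 1) → E n) |
          IsIncompatibleNormal U δ₀ p.2.1} := by
        simp only [IsIncompatibleNormal, Set.ofPred_forall]
        refine isClosed_iInter fun b' => isClosed_iInter fun _ => ?_
        exact isClosed_le (by fun_prop) continuous_const
      have e3 : IsClosed {p : Mat n × E n × (Fin (n - 1) → E n) | Orthonormal ℝ p.2.2} := by
        simp only [orthonormal_iff_ite, Set.ofPred_forall]
        refine isClosed_iInter fun a => isClosed_iInter fun c => ?_
        exact isClosed_eq (by fun_prop) continuous_const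
      have e4 : IsClosed {p : Mat n × E n × (Fin (n - 1) → E n) |
          ∀ l, inner ℝ (p.2.2 l) p.2.1 = 0} := by
        simp only [Set.ofPred_forall]
        refine isClosed_iInter fun a => ?_
        exact isClosed_eq (by fun_prop) continuous_const
      exact e1.inter (e2.inter (e3.inter e4))
    refine (hbig.inter_right hcl).of_isClosed_subset ?_ ?_
    · refine IsClosed.inter ?_ hcl
      exact isCompact_specialOrthogonalGroup.isClosed.preimage continuous_fst
    · rintro ⟨Q, b, τ⟩ ⟨h1, h2, h3, h4, h5⟩
      refine ⟨⟨h1, by simp [h2], fun l _ => by simp [h4.1 l]⟩, h2, h3, h4, h5⟩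
  have hf : Continuous f := by
    refine continuous_finsetSum _ fun l _ => Continuous.norm ?_
    simp only [Matrix.toLpLin_apply]
    refine (PiLp.continuous_toLp 2 _).comp ?_
    refine Continuous.matrix_mulVec ?_ ?_
    · exact continuous_const.sub (continuous_fst.matrix_mul continuous_const)
    · exact (PiLp.continuous_ofLp 2 _).comp (by fun_prop)
  have hpos : ∀ p ∈ S, 0 < f p := by
    rintro ⟨Q, b, τ⟩ ⟨h1, h2, h3, h4, h5⟩
    refine lt_of_le_of_ne (Finset.sum_nonneg fun _ _ => norm_nonneg _) fun h0 => ?_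
    have hz : ∀ l, Matrix.toEuclideanLin (U i - Q * U j) (τ l) = 0 := by
      intro l
      have := (Finset.sum_eq_zero_iff_of_nonneg (fun _ _ => norm_nonneg _)).1 h0.symm l
        (Finset.mem_univ _)
      simpa using this
    have hr := eq_vecMulVec_of_tangential_zero h2 (tangential_zero_of_orthonormal h2 h4 h5 hz)
    -- a zero is a rank-one connection with the incompatible normal `b`
    have hone : IsRankOneNormal U b := by
      refine ⟨h2, i, j, hij, Q, h1, _, ?_, hr⟩
      intro ha
      rw [ha] at hr
      have hzero : U i - Q * U j = 0 := by
        rw [hr]; ext a c; simp [Matrix.vecMulVec_apply]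
      have := hsep i j hij (U i) ⟨1, one_mem _, by simp⟩ (Q * U j) ⟨Q, h1, rfl⟩
      rw [sub_eq_zero.1 hzero, dist_self] at this
      linarith
    have := h3 b hone
    rw [real_inner_self_eq_norm_sq, h2] at this
    norm_num at this
    linarith
  have hr : ∃ r : ℝ, 0 < r ∧ ∀ p ∈ S, r ≤ f p := by
    rcases S.eq_empty_or_nonempty with hE | hE
    · exact ⟨1, one_pos, by simp [hE]⟩
    · obtain ⟨p, hp, hmin⟩ := hS.exists_isMinOn hE hf.continuousOn
      exact ⟨f p, hpos p hp, fun q hq => hmin hq⟩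
  obtain ⟨r, hr0, hr⟩ := hr
  -- the sum of the `n - 1` norms is at least `r`; `n + 1` avoids a division by zero
  refine ⟨r / (n + 1), by positivity, fun Q hQ b hb hbi τ hτ hτb => ?_⟩
  by_contra! hlt
  have h1 := hr (Q, b, τ) ⟨hQ, hb, hbi, hτ, hτb⟩
  have h2 : f (Q, b, τ) ≤ ∑ _l : Fin (n - 1), r / (n + 1) :=
    Finset.sum_le_sum fun l _ => (hlt l).le
  rw [Finset.sum_const, Finset.card_univ, Fintype.card_fin, nsmul_eq_mul] at h2
  have h3 : ((n - 1 : ℕ) : ℝ) ≤ n := by exact_mod_cast Nat.sub_le n 1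
  have h4 : ((n - 1 : ℕ) : ℝ) * (r / (n + 1)) < r := by
    rw [mul_div_assoc', div_lt_iff₀ (by positivity)]
    nlinarith
  linarith

lemma exists_hasTangentialGap {U : Fin k → Mat n} {d : ℝ} (hd : 0 < d)
    (hsep : WellsSeparated U d) {δ₀ : ℝ} (hδ₀ : 0 < δ₀) :
    ∃ dbar : ℝ, 0 < dbar ∧ HasTangentialGap U δ₀ dbar := by
  have h : ∀ p : Fin k × Fin k, ∃ r : ℝ, 0 < r ∧ (p.1 ≠ p.2 →
      ∀ Q ∈ Matrix.specialOrthogonalGroup (Fin n) ℝ,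
      ∀ b : E n, ‖b‖ = 1 → IsIncompatibleNormal U δ₀ b →
      ∀ τ : Fin (n - 1) → E n, Orthonormal ℝ τ → (∀ l, inner ℝ (τ l) b = 0) →
      ∃ l, r ≤ ‖Matrix.toEuclideanLin (U p.1 - Q * U p.2) (τ l)‖) := by
    intro p
    by_cases hp : p.1 = p.2
    · exact ⟨1, one_pos, fun h => absurd hp h⟩
    · obtain ⟨r, hr, h⟩ := exists_gap_pair hd hsep hδ₀ hp
      exact ⟨r, hr, fun _ => h⟩
  choose r hr hgap using h
  obtain ⟨ε, hε, hle⟩ : ∃ ε : ℝ, 0 < ε ∧ ∀ p, ε ≤ r p := by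
    rcases isEmpty_or_nonempty (Fin k × Fin k) with he | he
    · exact ⟨1, one_pos, fun p => he.elim p⟩
    · obtain ⟨p, hp⟩ := Finite.exists_min r
      exact ⟨r p, hr p, hp⟩
  refine ⟨ε, hε, fun i j hij Q hQ b hb hbi τ hτ hτb => ?_⟩
  obtain ⟨l, hl⟩ := hgap (i, j) hij Q hQ b hb hbi τ hτ hτb
  exact ⟨l, (hle _).trans hl⟩

end Gap

/-! ### Translation bounds and perimeter -/

section Translation

variable {n : ℕ}

/-- `A` satisfies the translation bound with constant `P` in `Ω`: the set of points `x` for which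
membership in `A` changes between `x - h` and `x`, along a segment inside `Ω`, has measure at most
`P |h|`. -/
def HasTranslationBound (Ω A : Set (E n)) (P : ℝ≥0) : Prop :=
  ∀ h : E n, volume {x | segment ℝ (x - h) x ⊆ Ω ∧ ¬ (x - h ∈ A ↔ x ∈ A)} ≤ P * ‖h‖ₑ

lemma exists_segment_subset {Ω K : Set (E n)} (hΩ : IsOpen Ω) (hK : IsCompact K) (hKΩ : K ⊆ Ω) :
    ∃ δ > 0, ∀ h : E n, ‖h‖ < δ → ∀ x ∈ K, segment ℝ (x - h) x ⊆ Ω := by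
  obtain ⟨δ, hδ, hsub⟩ := hK.exists_thickening_subset_open hΩ hKΩ
  refine ⟨δ, hδ, fun h hh x hx => ?_⟩
  have hball : Metric.ball x δ ⊆ Ω :=
    (Metric.ball_subset_thickening hx δ).trans hsub
  refine ((convex_ball x δ).segment_subset ?_ (Metric.mem_ball_self hδ)).trans hball
  simpa [Metric.mem_ball, dist_eq_norm] using hh

lemma charFun_nonneg (A : Set (E n)) (x : E n) : 0 ≤ charFun A x :=
  Set.indicator_nonneg (fun _ _ => zero_le_one) x

lemma charFun_le_one (A : Set (E n)) (x : E n) : charFun A x ≤ 1 :=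
  Set.indicator_le_self' (fun _ _ => zero_le_one) x

/-- The difference quotients of the characteristic function in the direction `v`, tested against
functions supported in `Ω`, are controlled by the translation bound. -/
lemma HasTranslationBound.abs_integral_fderiv_le {Ω A : Set (E n)} {P : ℝ≥0} (hΩ : IsOpen Ω)
    (hA : MeasurableSet A) (hAfin : volume A ≠ ⊤) (hP : HasTranslationBound Ω A P)
    {f : E n → ℝ} (hf : ContDiff ℝ 1 f) (hfc : HasCompactSupport f) (hfΩ : tsupport f ⊆ Ω)
    (hf1 : ∀ x, |f x| ≤ 1) (v : E n) :
    |∫ x in A, fderiv ℝ f x v| ≤ P * ‖v‖ := by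
  obtain ⟨L, hL⟩ := hf.lipschitzWith_of_hasCompactSupport hfc one_ne_zero
  have hg : Integrable (charFun A) (volume : Measure (E n)) :=
    (integrable_indicator_iff hA).2 (integrableOn_const hAfin)
  have hlim := hL.integral_inv_smul_sub_mul_tendsto_integral_lineDeriv_mul hg v
  have heq : ∫ x, lineDeriv ℝ f x v * charFun A x = ∫ x in A, fderiv ℝ f x v := by
    rw [← integral_indicator hA]
    congr 1
    ext x
    rw [((hf.differentiable one_ne_zero) x).lineDeriv_eq_fderiv]
    by_cases hx : x ∈ A <;> simp [charFun, hx]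
  rw [heq] at hlim
  obtain ⟨δ, hδ, hseg⟩ := exists_segment_subset hΩ hfc hfΩ
  have hsmall : ∀ᶠ t : ℝ in 𝓝[>] 0, t < δ / (‖v‖ + 1) :=
    nhdsWithin_le_nhds (Iio_mem_nhds (by positivity))
  refine le_of_tendsto hlim.abs ?_
  filter_upwards [self_mem_nhdsWithin, hsmall] with t ht htδ
  have ht : 0 < t := ht
  have htv : ‖t • v‖ < δ := by
    rw [norm_smul, Real.norm_of_nonneg ht.le]
    rw [lt_div_iff₀ (by positivity)] at htδ
    nlinarith [norm_nonneg v]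
  have hfb : ∀ x, ‖f x‖ ≤ 1 := hf1
  have hi1 : Integrable (fun x => f (x + t • v) * charFun A x) :=
    hg.bdd_mul (c := 1) (hf.continuous.comp (continuous_add_const _)).aestronglyMeasurable
      (Eventually.of_forall fun x => hfb _)
  have hi2 : Integrable (fun x => f x * charFun A x) :=
    hg.bdd_mul (c := 1) hf.continuous.aestronglyMeasurable (Eventually.of_forall fun x => hfb _)
  have hi3 : Integrable (fun x => f x * charFun A (x - t • v)) :=
    (hg.comp_sub_right (t • v)).bdd_mul (c := 1) hf.continuous.aestronglyMeasurable
      (Eventually.of_forall fun x => hfb _)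
  -- the difference quotient is moved from `f` to the characteristic function
  have hshift : ∫ x, f (x + t • v) * charFun A x = ∫ x, f x * charFun A (x - t • v) := by
    rw [← integral_add_right_eq_self (fun x => f x * charFun A (x - t • v)) (t • v)]
    simp
  have hq : ∫ x, (t⁻¹ • (f (x + t • v) - f x)) * charFun A x
      = t⁻¹ * ∫ x, f x * (charFun A (x - t • v) - charFun A x) := by
    have e1 : ∀ x, (t⁻¹ • (f (x + t • v) - f x)) * charFun A x
        = t⁻¹ * (f (x + t • v) * charFun A x - f x * charFun A x) := fun x => by
      simp only [smul_eq_mul]; ring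
    have e2 : ∀ x, f x * (charFun A (x - t • v) - charFun A x)
        = f x * charFun A (x - t • v) - f x * charFun A x := fun x => by ring
    simp only [e1, e2]
    rw [integral_const_mul, integral_sub hi1 hi2, integral_sub hi3 hi2, hshift]
  rw [hq, abs_mul, abs_of_pos (inv_pos.2 ht)]
  let S : Set (E n) := tsupport f ∩ {x | ¬ (x - t • v ∈ A ↔ x ∈ A)}
  have hSm : MeasurableSet S := by
    refine (isClosed_tsupport f).measurableSet.inter ?_
    have h1 : MeasurableSet {x : E n | x - t • v ∈ A} := (measurable_sub_const _) hA
    exact (h1.iff hA).compl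
  have hS : volume S ≤ P * ‖t • v‖ₑ :=
    (measure_mono (t := {x | segment ℝ (x - t • v) x ⊆ Ω ∧ ¬ (x - t • v ∈ A ↔ x ∈ A)})
      fun x hx => ⟨hseg _ htv x hx.1, hx.2⟩).trans (hP (t • v))
  have hSfin : volume S ≠ ⊤ :=
    ne_top_of_le_ne_top (ENNReal.mul_ne_top ENNReal.coe_ne_top enorm_ne_top) hS
  have hbound : |∫ x, f x * (charFun A (x - t • v) - charFun A x)| ≤ volume.real S := by
    rw [← Real.norm_eq_abs, ← integral_indicator_one hSm]
    refine norm_integral_le_of_norm_le ?_ (Eventually.of_forall fun x => ?_)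
    · exact (integrable_indicator_iff hSm).2 (integrableOn_const hSfin)
    · by_cases hx : x ∈ tsupport f
      · by_cases hx' : x - t • v ∈ A ↔ x ∈ A
        · have : charFun A (x - t • v) = charFun A x := by
            by_cases hxA : x ∈ A
            · simp [charFun, hxA, hx'.2 hxA]
            · simp [charFun, hxA, mt hx'.1 hxA]
          rw [this, sub_self, mul_zero, norm_zero]
          exact Set.indicator_nonneg (fun _ _ => zero_le_one) x
        · rw [Set.indicator_of_mem (show x ∈ S from ⟨hx, hx'⟩), norm_mul]
          refine mul_le_one₀ (hfb x) (norm_nonneg _) ?_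
          rw [Real.norm_eq_abs, abs_le]
          constructor <;> linarith [charFun_nonneg A x, charFun_le_one A x,
            charFun_nonneg A (x - t • v), charFun_le_one A (x - t • v)]
      · rw [image_eq_zero_of_notMem_tsupport hx, zero_mul, norm_zero]
        exact Set.indicator_nonneg (fun _ _ => zero_le_one) x
  have hreal : volume.real S ≤ P * (t * ‖v‖) := by
    have := ENNReal.toReal_mono (ENNReal.mul_ne_top ENNReal.coe_ne_top enorm_ne_top) hS
    rwa [ENNReal.toReal_mul, toReal_enorm, norm_smul, Real.norm_of_nonneg ht.le] at this
  calc t⁻¹ * |∫ x, f x * (charFun A (x - t • v) - charFun A x)|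
      ≤ t⁻¹ * (P * (t * ‖v‖)) := by gcongr; exact hbound.trans hreal
    _ = P * ‖v‖ := by field_simp

lemma continuous_divergence {φ : E n → E n} (hφ : ContDiff ℝ 1 φ) :
    Continuous (divergence φ) := by
  unfold divergence
  refine continuous_finsetSum _ fun i _ => ?_
  have := (hφ.continuous_fderiv one_ne_zero).clm_apply
    (continuous_const (y := EuclideanSpace.single i (1 : ℝ)))
  fun_prop

lemma divergence_eq_zero_of_notMem {φ : E n → E n} {x : E n} (hx : x ∉ tsupport φ) :
    divergence φ x = 0 := by
  have : fderiv ℝ φ x = 0 := by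
    by_contra h
    exact hx (support_fderiv_subset ℝ h)
  simp [divergence, this]

lemma divergence_eq_sum {φ : E n → E n} (hφ : ContDiff ℝ 1 φ) (x : E n) :
    divergence φ x
      = ∑ i, fderiv ℝ (fun y => φ y i) x (EuclideanSpace.single i 1) := by
  unfold divergence
  refine Finset.sum_congr rfl fun i _ => ?_
  have h := ((EuclideanSpace.proj i : E n →L[ℝ] ℝ).hasFDerivAt.comp x
    ((hφ.differentiable one_ne_zero) x).hasFDerivAt)
  have h' : HasFDerivAt (fun y => φ y i)
      ((EuclideanSpace.proj i : E n →L[ℝ] ℝ).comp (fderiv ℝ φ x)) x := h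
  rw [h'.fderiv]
  simp

/-- A translation bound bounds the perimeter: each of the `n` partial derivatives in the divergence
contributes at most `P`. -/
lemma HasTranslationBound.perimeter_le {Ω A : Set (E n)} {P : ℝ≥0} (hΩ : IsOpen Ω)
    (hA : MeasurableSet A) (hAfin : volume A ≠ ⊤) (hP : HasTranslationBound Ω A P) :
    perimeter Ω A ≤ n * P := by
  refine iSup₂_le fun φ hφ => ?_
  obtain ⟨hφ1, hφc, hφΩ, hφb⟩ := hφ
  have hcomp : ∀ i, ContDiff ℝ 1 (fun y => φ y i) := fun i =>
    (EuclideanSpace.proj i : E n →L[ℝ] ℝ).contDiff.comp hφ1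
  have hsupp : ∀ i, tsupport (fun y => φ y i) ⊆ tsupport φ := fun i =>
    closure_mono fun x hx => by
      rw [Function.mem_support] at hx ⊢
      intro h0; exact hx (by simp [h0])
  have hint : ∀ i, IntegrableOn (fun x => fderiv ℝ (fun y => φ y i) x
      (EuclideanSpace.single i 1)) A := by
    intro i
    have hc : Continuous (fun x => fderiv ℝ (fun y => φ y i) x (EuclideanSpace.single i 1)) :=
      ((hcomp i).continuous_fderiv one_ne_zero).clm_apply continuous_const
    have hcs : HasCompactSupport (fun x => fderiv ℝ (fun y => φ y i) x
        (EuclideanSpace.single i 1)) := by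
      refine HasCompactSupport.fderiv_apply (𝕜 := ℝ) ?_ _
      exact hφc.of_isClosed_subset (isClosed_tsupport _) (hsupp i)
    exact (hc.integrable_of_hasCompactSupport hcs).integrableOn
  simp only [divergence_eq_sum hφ1]
  rw [integral_finsetSum _ fun i _ => hint i]
  have hle : ∑ i, ∫ x in A, fderiv ℝ (fun y => φ y i) x (EuclideanSpace.single i 1)
      ≤ ∑ _i : Fin n, (P : ℝ) := by
    refine Finset.sum_le_sum fun i _ => (le_abs_self _).trans ?_
    have := hP.abs_integral_fderiv_le hΩ hA hAfin (hcomp i)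
      (hφc.of_isClosed_subset (isClosed_tsupport _) (hsupp i)) ((hsupp i).trans hφΩ)
      (fun x => (PiLp.norm_apply_le (φ x) i).trans (hφb x)) (EuclideanSpace.single i 1)
    simpa using this
  refine (ENNReal.ofReal_le_ofReal hle).trans ?_
  rw [Finset.sum_const, Finset.card_univ, Fintype.card_fin, nsmul_eq_mul,
    ENNReal.ofReal_mul (by positivity)]
  simp

end Translation

/-! ### Compactness of sets with a uniform translation bound -/

section Compactness

variable {n : ℕ}

/-- Sequential weak compactness of characteristic functions: the Banach–Alaoglu theorem in `L²(μ)`,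
tested against characteristic functions. -/
lemma exists_subseq_tendsto_measure_inter (μ : Measure (E n)) [IsFiniteMeasure μ]
    {A : ℕ → Set (E n)} (hA : ∀ m, MeasurableSet (A m)) :
    ∃ σ : ℕ → ℕ, StrictMono σ ∧ ∀ S, MeasurableSet S →
      ∃ l, Tendsto (fun m => μ.real (A (σ m) ∩ S)) atTop (𝓝 l) := by
  have : Fact ((1 : ℝ≥0∞) ≤ 2) := ⟨one_le_two⟩
  have : Fact ((2 : ℝ≥0∞) ≠ ⊤) := ⟨ENNReal.ofNat_ne_top⟩
  let V := Lp ℝ 2 μ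
  let f : ℕ → V := fun m => indicatorConstLp 2 (hA m) (measure_ne_top μ _) (1 : ℝ)
  let F : ℕ → WeakDual ℝ V := fun m => StrongDual.toWeakDual (InnerProductSpace.toDual ℝ V (f m))
  let R : ℝ := μ.real Set.univ ^ (1 / (2 : ℝ≥0∞).toReal)
  have hF : ∀ m, F m ∈ WeakDual.toStrongDual ⁻¹' Metric.closedBall (0 : StrongDual ℝ V) R := by
    intro m
    have h1 : ‖f m‖ ≤ R := by
      refine (norm_indicatorConstLp_le).trans ?_
      rw [norm_one, one_mul]
      exact Real.rpow_le_rpow measureReal_nonneg (measureReal_mono (Set.subset_univ _))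
        (by positivity)
    rw [Set.mem_preimage, mem_closedBall_zero_iff]
    change ‖InnerProductSpace.toDual ℝ V (f m)‖ ≤ R
    rwa [LinearIsometryEquiv.norm_map]
  obtain ⟨Λ, -, σ, hσ, hlim⟩ := WeakDual.isSeqCompact_closedBall ℝ V 0 R hF
  refine ⟨σ, hσ, fun S hS => ?_⟩
  let g : V := indicatorConstLp 2 hS (measure_ne_top μ _) (1 : ℝ)
  refine ⟨Λ g, ?_⟩
  have h1 := ((WeakDual.eval_continuous g).tendsto Λ).comp hlim
  refine h1.congr fun m => ?_
  change inner ℝ (f (σ m)) g = _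
  exact L2.real_inner_indicatorConstLp_one_indicatorConstLp_one (hA _) hS

lemma eLpNorm_charFun_sub (μ : Measure (E n)) {A B : Set (E n)} (hA : MeasurableSet A)
    (hB : MeasurableSet B) :
    eLpNorm (charFun A - charFun B) 1 μ = μ (symmDiff A B) := by
  rw [eLpNorm_one_eq_lintegral_enorm, ← lintegral_indicator_one (hA.symmDiff hB)]
  congr 1
  ext x
  by_cases h1 : x ∈ A <;> by_cases h2 : x ∈ B <;>
    simp [charFun, Set.mem_symmDiff, h1, h2, Set.indicator]

/-- The average over `z ∈ ball 0 ρ` of the measure of the points of `K` where membership in `A`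
changes under translation by `z` is at most `P ρ`. -/
lemma HasTranslationBound.lintegral_mismatch_le {Ω A K : Set (E n)} {P : ℝ≥0} {ρ : ℝ}
    (hA : MeasurableSet A) (hK : MeasurableSet K)
    (hP : HasTranslationBound Ω A P)
    (hseg : ∀ h : E n, ‖h‖ < ρ → ∀ x ∈ K, segment ℝ (x - h) x ⊆ Ω) :
    ∫⁻ x in K, volume {z | z ∈ Metric.ball (0 : E n) ρ ∧ ¬ (x - z ∈ A ↔ x ∈ A)}
      ≤ P * ENNReal.ofReal ρ * volume (Metric.ball (0 : E n) ρ) := by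
  let W : Set (E n × E n) :=
    {p | p.1 ∈ K ∧ p.2 ∈ Metric.ball (0 : E n) ρ ∧ ¬ (p.1 - p.2 ∈ A ↔ p.1 ∈ A)}
  have hW : MeasurableSet W := by
    refine (measurable_fst hK).inter ((measurable_snd measurableSet_ball).inter ?_)
    have h1 : MeasurableSet {p : E n × E n | p.1 - p.2 ∈ A} :=
      (measurable_fst.sub measurable_snd) hA
    exact (h1.iff (measurable_fst hA)).compl
  have e1 : ∫⁻ x in K, volume {z | z ∈ Metric.ball (0 : E n) ρ ∧ ¬ (x - z ∈ A ↔ x ∈ A)}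
      = (volume.prod volume) W := by
    rw [Measure.prod_apply hW, ← lintegral_indicator hK]
    refine lintegral_congr fun x => ?_
    by_cases hx : x ∈ K <;> simp [W, hx]
  rw [e1, Measure.prod_apply_symm hW]
  calc ∫⁻ z, volume ((fun x => (x, z)) ⁻¹' W)
      ≤ ∫⁻ z, (Metric.ball (0 : E n) ρ).indicator (fun _ => P * ENNReal.ofReal ρ) z := by
        refine lintegral_mono fun z => ?_
        by_cases hz : z ∈ Metric.ball (0 : E n) ρ
        · rw [Set.indicator_of_mem hz]
          have hz' : ‖z‖ < ρ := by simpa using hz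
          refine (measure_mono (t := {x | segment ℝ (x - z) x ⊆ Ω ∧ ¬ (x - z ∈ A ↔ x ∈ A)})
            fun x hx => ⟨hseg z hz' x hx.1, hx.2.2⟩).trans ((hP z).trans ?_)
          gcongr
          rw [← ofReal_norm]
          exact ENNReal.ofReal_le_ofReal hz'.le
        · have : (fun x => (x, z)) ⁻¹' W = ∅ := by
            ext x; simp only [Set.mem_preimage, Set.mem_empty_iff_false, iff_false]
            exact fun hx => hz hx.2.1
          rw [this, measure_empty]
          exact zero_le
    _ = P * ENNReal.ofReal ρ * volume (Metric.ball (0 : E n) ρ) := by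
        rw [lintegral_indicator measurableSet_ball, setLIntegral_const]

/-- Inside `K`, the measure of `A ∩ ball x ρ` is the measure of the translations in
`ball 0 ρ` that take `x` into `A`. -/
lemma volume_translations_eq {Ω A K : Set (E n)} {ρ : ℝ} (hA : MeasurableSet A)
    (hΩ : MeasurableSet Ω)
    (hseg : ∀ h : E n, ‖h‖ < ρ → ∀ x ∈ K, segment ℝ (x - h) x ⊆ Ω) {x : E n} (hx : x ∈ K) :
    volume {z | z ∈ Metric.ball (0 : E n) ρ ∧ x - z ∈ A}
      = volume.restrict Ω (A ∩ Metric.ball x ρ) := by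
  rw [Measure.restrict_apply' hΩ]
  have hpre : {z | z ∈ Metric.ball (0 : E n) ρ ∧ x - z ∈ A}
      = (fun z => x - z) ⁻¹' (A ∩ Metric.ball x ρ ∩ Ω) := by
    ext z
    simp only [Set.mem_ofPred_eq, Set.mem_preimage, Set.mem_inter_iff,
      Metric.mem_ball, dist_eq_norm, sub_zero]
    constructor
    · rintro ⟨h1, h2⟩
      exact ⟨⟨h2, by simpa using h1⟩, hseg z h1 x hx (left_mem_segment ℝ _ _)⟩
    · rintro ⟨⟨h1, h2⟩, -⟩
      exact ⟨by simpa using h2, h1⟩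
  rw [hpre]
  exact (Measure.measurePreserving_sub_left volume x).measure_preimage
    ((hA.inter measurableSet_ball).inter hΩ).nullMeasurableSet

lemma measurable_measure_inter_ball (μ : Measure (E n)) [SFinite μ] {A : Set (E n)}
    (hA : MeasurableSet A) (ρ : ℝ) : Measurable fun x => μ (A ∩ Metric.ball x ρ) := by
  have hW : MeasurableSet {p : E n × E n | p.2 ∈ A ∧ dist p.2 p.1 < ρ} :=
    (measurable_snd hA).inter (measurableSet_lt (measurable_snd.dist measurable_fst)
      measurable_const)
  exact measurable_measure_prodMk_left hW

/-- Two sets with the same translation bound are close on `K` if their local averages are: where one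
of them contains `x` and the other does not, either their averages over `ball x ρ` differ, or many
translations by `z ∈ ball 0 ρ` change membership in one of them. -/
lemma HasTranslationBound.volume_symmDiff_le {Ω A B K : Set (E n)} {P : ℝ≥0} {ρ : ℝ}
    (hΩ : MeasurableSet Ω) (hΩfin : volume Ω ≠ ⊤)
    (hA : MeasurableSet A) (hB : MeasurableSet B) (hK : MeasurableSet K)
    (hPA : HasTranslationBound Ω A P) (hPB : HasTranslationBound Ω B P)
    (hseg : ∀ h : E n, ‖h‖ < ρ → ∀ x ∈ K, segment ℝ (x - h) x ⊆ Ω) :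
    volume (Metric.ball (0 : E n) ρ) * volume (K ∩ symmDiff A B)
      ≤ 2 * (P * ENNReal.ofReal ρ * volume (Metric.ball (0 : E n) ρ))
        + ∫⁻ x in K, ENNReal.ofReal |(volume.restrict Ω).real (A ∩ Metric.ball x ρ)
            - (volume.restrict Ω).real (B ∩ Metric.ball x ρ)| := by
  set V := volume (Metric.ball (0 : E n) ρ)
  have hfin : IsFiniteMeasure (volume.restrict Ω) :=
    ⟨by rw [Measure.restrict_apply_univ]; exact hΩfin.lt_top⟩
  -- the measure of the translations in the ball that change membership
  let mis : Set (E n) → E n → ℝ≥0∞ := fun C x =>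
    volume {z | z ∈ Metric.ball (0 : E n) ρ ∧ ¬ (x - z ∈ C ↔ x ∈ C)}
  have hmeas : ∀ C, MeasurableSet C → Measurable (mis C) := by
    intro C hC
    have hW : MeasurableSet {p : E n × E n |
        p.2 ∈ Metric.ball (0 : E n) ρ ∧ ¬ (p.1 - p.2 ∈ C ↔ p.1 ∈ C)} :=
      (measurable_snd measurableSet_ball).inter
        (((measurable_fst.sub measurable_snd) hC).iff (measurable_fst hC)).compl
    exact measurable_measure_prodMk_left hW
  have hcomp : ∀ C D : Set (E n), MeasurableSet C → MeasurableSet D → ∀ x ∈ K, x ∈ C → x ∉ D →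
      V ≤ mis C x + mis D x + ENNReal.ofReal |(volume.restrict Ω).real (C ∩ Metric.ball x ρ)
            - (volume.restrict Ω).real (D ∩ Metric.ball x ρ)| := by
    intro C D hC hD x hx hxC hxD
    have h1 : V ≤ mis C x + volume {z | z ∈ Metric.ball (0 : E n) ρ ∧ x - z ∈ C} := by
      refine (measure_mono fun z hz => ?_).trans (measure_union_le _ _)
      by_cases hzC : x - z ∈ C
      · exact Or.inr ⟨hz, hzC⟩
      · exact Or.inl ⟨hz, by simp [hzC, hxC]⟩
    have h2 : mis D x = volume {z | z ∈ Metric.ball (0 : E n) ρ ∧ x - z ∈ D} := by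
      simp only [mis, hxD, iff_false, not_not]
    rw [volume_translations_eq hC hΩ hseg hx] at h1
    rw [volume_translations_eq hD hΩ hseg hx] at h2
    refine h1.trans ?_
    rw [add_assoc]
    gcongr
    rw [h2, ← ENNReal.ofReal_toReal (measure_ne_top (volume.restrict Ω) (C ∩ _)),
      ← ENNReal.ofReal_toReal (measure_ne_top (volume.restrict Ω) (D ∩ _)),
      ← ENNReal.ofReal_add ENNReal.toReal_nonneg (abs_nonneg _)]
    refine ENNReal.ofReal_le_ofReal ?_
    have := le_abs_self ((volume.restrict Ω).real (C ∩ Metric.ball x ρ)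
            - (volume.restrict Ω).real (D ∩ Metric.ball x ρ))
    simp only [Measure.real] at this ⊢
    linarith
  calc V * volume (K ∩ symmDiff A B)
      = ∫⁻ x in K, (symmDiff A B).indicator (fun _ => V) x := by
        rw [lintegral_indicator (hA.symmDiff hB), setLIntegral_const,
          Measure.restrict_apply (hA.symmDiff hB), Set.inter_comm]
    _ ≤ ∫⁻ x in K, (mis A x + mis B x
          + ENNReal.ofReal |(volume.restrict Ω).real (A ∩ Metric.ball x ρ)
            - (volume.restrict Ω).real (B ∩ Metric.ball x ρ)|) := by
        refine setLIntegral_mono' hK fun x hx => ?_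
        by_cases hxs : x ∈ symmDiff A B
        · rw [Set.indicator_of_mem hxs]
          rcases hxs with ⟨h1, h2⟩ | ⟨h1, h2⟩
          · exact hcomp A B hA hB x hx h1 h2
          · rw [add_comm (mis A x), abs_sub_comm]
            exact hcomp B A hB hA x hx h1 h2
        · rw [Set.indicator_of_notMem hxs]; exact zero_le
    _ ≤ _ := by
        rw [lintegral_add_left (f := fun x => mis A x + mis B x) ((hmeas A hA).add (hmeas B hB)),
          lintegral_add_left (hmeas A hA), two_mul]
        gcongr
        · exact hPA.lintegral_mismatch_le hA hK hseg
        · exact hPB.lintegral_mismatch_le hB hK hseg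

/-- Sets with a uniform translation bound, whose local averages converge, form a Cauchy sequence
with respect to the measure of the symmetric difference. -/
lemma cauchy_of_translationBound {Ω : Set (E n)} {P : ℝ≥0} (hΩ : IsOpen Ω)
    (hΩfin : volume Ω ≠ ⊤) {A : ℕ → Set (E n)} (hA : ∀ m, MeasurableSet (A m))
    (hP : ∀ m, HasTranslationBound Ω (A m) P)
    (hlim : ∀ S, MeasurableSet S →
      ∃ l, Tendsto (fun m => (volume.restrict Ω).real (A m ∩ S)) atTop (𝓝 l))
    {ε : ℝ≥0∞} (hε : ε ≠ 0) :
    ∃ N, ∀ m ≥ N, ∀ l ≥ N, volume.restrict Ω (symmDiff (A m) (A l)) < ε := by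
  have hfin : IsFiniteMeasure (volume.restrict Ω) :=
    ⟨by rw [Measure.restrict_apply_univ]; exact hΩfin.lt_top⟩
  obtain ⟨ε', hε', hεlt⟩ : ∃ ε' : ℝ≥0, 0 < ε' ∧ 5 * (ε' : ℝ≥0∞) < ε := by
    obtain ⟨e, he0, he⟩ := ENNReal.lt_iff_exists_nnreal_btwn.1 (pos_iff_ne_zero.2 hε)
    have he0' : 0 < e := by exact_mod_cast he0
    refine ⟨e / 5, by positivity, lt_of_le_of_lt (le_of_eq ?_) he⟩
    rw [show (5 : ℝ≥0∞) = ((5 : ℝ≥0) : ℝ≥0∞) from rfl, ← ENNReal.coe_mul]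
    congr 1
    field_simp
  have hε0 : (ε' : ℝ≥0∞) ≠ 0 := by exact_mod_cast hε'.ne'
  -- outside `K` the sets are not controlled, and `ρ` is the radius of the balls for the averages
  obtain ⟨K, hKΩ, hK, hKlt⟩ := hΩ.measurableSet.exists_isCompact_sdiff_lt hΩfin hε0
  obtain ⟨δ, hδ, hseg⟩ := exists_segment_subset hΩ hK hKΩ
  obtain ⟨ρ, hρ0, hρδ, hρP⟩ : ∃ ρ : ℝ, 0 < ρ ∧ ρ ≤ δ ∧ P * ENNReal.ofReal ρ ≤ ε' := by
    refine ⟨min δ (ε' / (P + 1)), by positivity, min_le_left _ _, ?_⟩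
    calc (P : ℝ≥0∞) * ENNReal.ofReal (min δ (ε' / (P + 1)))
        ≤ P * ENNReal.ofReal (ε' / (P + 1)) := by gcongr; exact min_le_right _ _
      _ = ENNReal.ofReal (P * (ε' / (P + 1))) := by
        rw [ENNReal.ofReal_mul P.coe_nonneg, ENNReal.ofReal_coe_nnreal]
      _ ≤ ENNReal.ofReal ε' := by
        refine ENNReal.ofReal_le_ofReal ?_
        rw [mul_div_assoc', div_le_iff₀ (by positivity)]
        nlinarith [P.coe_nonneg, ε'.coe_nonneg]
      _ = ε' := ENNReal.ofReal_coe_nnreal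
  have hseg' : ∀ h : E n, ‖h‖ < ρ → ∀ x ∈ K, segment ℝ (x - h) x ⊆ Ω :=
    fun h hh => hseg h (hh.trans_le hρδ)
  set V := volume (Metric.ball (0 : E n) ρ)
  have hV0 : V ≠ 0 := (Metric.measure_ball_pos volume _ hρ0).ne'
  have hVtop : V ≠ ⊤ := measure_ball_lt_top.ne
  let a : ℕ → E n → ℝ := fun m x => (volume.restrict Ω).real (A m ∩ Metric.ball x ρ)
  have ha : ∀ m, Measurable (a m) := fun m =>
    (measurable_measure_inter_ball _ (hA m) ρ).ennreal_toReal
  choose b hb using fun x : E n => hlim (Metric.ball x ρ) measurableSet_ball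
  have hbm : Measurable b := measurable_of_tendsto_metrizable ha (tendsto_pi_nhds.2 hb)
  have hbound : ∀ m x, a m x ∈ Set.Icc 0 ((volume.restrict Ω).real Set.univ) := fun m x =>
    ⟨measureReal_nonneg, measureReal_mono (Set.subset_univ _)⟩
  have hbb : ∀ x, b x ∈ Set.Icc 0 ((volume.restrict Ω).real Set.univ) := fun x =>
    isClosed_Icc.mem_of_tendsto (hb x) (Eventually.of_forall fun m => hbound m x)
  have hKfin : IsFiniteMeasure (volume.restrict K) :=
    ⟨by rw [Measure.restrict_apply_univ]; exact hK.measure_lt_top⟩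
  have hdom : Tendsto (fun m => ∫⁻ x in K, ENNReal.ofReal |a m x - b x|) atTop (𝓝 0) := by
    have h0 : ∫⁻ _x in K, (0 : ℝ≥0∞) = 0 := by simp
    rw [← h0]
    refine tendsto_lintegral_of_dominated_convergence
      (fun _ => ENNReal.ofReal ((volume.restrict Ω).real Set.univ)) (fun m => ?_) (fun m => ?_)
      ?_ ?_
    · exact ((ha m).sub hbm).abs.ennreal_ofReal
    · refine Eventually.of_forall fun x => ENNReal.ofReal_le_ofReal ?_
      have h1 := hbound m x
      have h2 := hbb x
      rw [abs_le]
      constructor <;> linarith [h1.1, h1.2, h2.1, h2.2]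
    · rw [lintegral_const]
      exact ENNReal.mul_ne_top ENNReal.ofReal_ne_top (measure_ne_top _ _)
    · refine Eventually.of_forall fun x => ?_
      have h1 : Tendsto (fun m => |a m x - b x|) atTop (𝓝 |b x - b x|) :=
        ((hb x).sub_const (b x)).abs
      rw [sub_self, abs_zero] at h1
      simpa using ENNReal.tendsto_ofReal h1
  have hεV : (0 : ℝ≥0∞) < ε' * V := pos_iff_ne_zero.2 (mul_ne_zero hε0 hV0)
  obtain ⟨N, hN⟩ := eventually_atTop.1 ((tendsto_order.1 hdom).2 _ hεV)
  refine ⟨N, fun m hm l hl => lt_of_le_of_lt ?_ hεlt⟩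
  have hcl : volume (K ∩ symmDiff (A m) (A l)) ≤ 4 * ε' := by
    have h1 := (hP m).volume_symmDiff_le hΩ.measurableSet hΩfin (hA m) (hA l) hK.measurableSet
      (hP l) hseg'
    have h2 : ∫⁻ x in K, ENNReal.ofReal |a m x - a l x| ≤ 2 * (ε' * V) := by
      calc ∫⁻ x in K, ENNReal.ofReal |a m x - a l x|
          ≤ ∫⁻ x in K, (ENNReal.ofReal |a m x - b x| + ENNReal.ofReal |a l x - b x|) := by
            refine lintegral_mono fun x => ?_
            rw [← ENNReal.ofReal_add (abs_nonneg _) (abs_nonneg _)]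
            refine ENNReal.ofReal_le_ofReal ?_
            rw [abs_sub_comm (a l x)]
            exact abs_sub_le _ _ _
        _ = _ := lintegral_add_left ((ha m).sub hbm).abs.ennreal_ofReal _
        _ ≤ 2 * (ε' * V) := by rw [two_mul]; exact add_le_add (hN m hm).le (hN l hl).le
    have h3 : V * volume (K ∩ symmDiff (A m) (A l)) ≤ V * (4 * ε') := by
      refine h1.trans ((add_le_add (b := 2 * (ε' * V)) (by gcongr) h2).trans (le_of_eq ?_))
      ring
    exact (ENNReal.mul_le_mul_iff_right hV0 hVtop).1 h3
  calc volume.restrict Ω (symmDiff (A m) (A l))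
      = volume (symmDiff (A m) (A l) ∩ Ω) := Measure.restrict_apply' hΩ.measurableSet
    _ ≤ volume (Ω \ K ∪ K ∩ symmDiff (A m) (A l)) := by
        refine measure_mono fun x hx => ?_
        by_cases hxK : x ∈ K
        · exact Or.inr ⟨hxK, hx.1⟩
        · exact Or.inl ⟨hx.2, hxK⟩
    _ ≤ ε' + 4 * ε' := (measure_union_le _ _).trans (add_le_add hKlt.le hcl)
    _ = 5 * ε' := by ring

/-- The measure algebra is complete: a Cauchy sequence of sets converges to a set. -/
lemma exists_limit_set {Ω : Set (E n)} (hΩ : MeasurableSet Ω) (hΩfin : volume Ω ≠ ⊤)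
    {A : ℕ → Set (E n)} (hA : ∀ m, MeasurableSet (A m))
    (hC : ∀ ε : ℝ≥0∞, ε ≠ 0 → ∃ N, ∀ m ≥ N, ∀ l ≥ N,
      volume.restrict Ω (symmDiff (A m) (A l)) < ε) :
    ∃ B, B ⊆ Ω ∧ MeasurableSet B ∧
      Tendsto (fun m => volume.restrict Ω (symmDiff (A m) B)) atTop (𝓝 0) := by
  have hfin : IsFiniteMeasure (volume.restrict Ω) :=
    ⟨by rw [Measure.restrict_apply_univ]; exact hΩfin.lt_top⟩
  have hmem : ∀ m, MemLp (charFun (A m)) 1 (volume.restrict Ω) := fun m =>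
    memLp_indicator_const 1 (hA m) 1 (Or.inr (measure_ne_top _ _))
  let F : ℕ → Lp ℝ 1 (volume.restrict Ω) := fun m => (hmem m).toLp
  have hF : CauchySeq F := by
    rw [EMetric.cauchySeq_iff]
    intro ε hε
    obtain ⟨N, hN⟩ := hC ε hε.ne'
    refine ⟨N, fun m hm l hl => ?_⟩
    rw [Lp.edist_toLp_toLp, eLpNorm_charFun_sub _ (hA m) (hA l)]
    exact hN m hm l hl
  obtain ⟨f, hf⟩ := cauchySeq_tendsto_of_complete hF
  have hf' : Tendsto (fun m => eLpNorm (charFun (A m) - ⇑f) 1 (volume.restrict Ω)) atTop (𝓝 0) := by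
    have h1 := (Lp.tendsto_Lp_iff_tendsto_eLpNorm' F f).1 hf
    refine h1.congr fun m => eLpNorm_congr_ae ?_
    exact (hmem m).coeFn_toLp.sub (EventuallyEq.refl _ _)
  obtain ⟨τ, hτ, hae⟩ := (tendstoInMeasure_of_tendsto_eLpNorm one_ne_zero
    (fun m => (hmem m).aestronglyMeasurable) (Lp.aestronglyMeasurable f)
    hf').exists_seq_tendsto_ae
  have h01 : ∀ᵐ x ∂(volume.restrict Ω), f x = 0 ∨ f x = 1 := by
    filter_upwards [hae] with x hx
    have hcl : IsClosed ({0, 1} : Set ℝ) := (Set.toFinite _).isClosed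
    have := hcl.mem_of_tendsto hx (Eventually.of_forall fun m => by
      by_cases hxA : x ∈ A (τ m) <;> simp [charFun, hxA])
    simpa using this
  have hBm : MeasurableSet {x | f x = 1} :=
    (Lp.stronglyMeasurable f).measurable (measurableSet_singleton 1)
  refine ⟨{x | f x = 1} ∩ Ω, Set.inter_subset_right, hBm.inter hΩ, ?_⟩
  refine hf'.congr fun m => ?_
  rw [← eLpNorm_charFun_sub _ (hA m) (hBm.inter hΩ)]
  refine eLpNorm_congr_ae ?_
  filter_upwards [h01, ae_restrict_mem hΩ] with x hx hxΩ
  rcases hx with hx | hx <;> simp [charFun, hx, hxΩ]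

/-- Sets with a uniform translation bound are sequentially compact in `L¹(Ω)`: the weak convergence
of local averages is upgraded to convergence in measure. -/
lemma exists_subseq_limit_set {Ω : Set (E n)} {P : ℝ≥0} (hΩ : IsOpen Ω)
    (hΩfin : volume Ω ≠ ⊤) {A : ℕ → Set (E n)} (hA : ∀ m, MeasurableSet (A m))
    (hP : ∀ m, HasTranslationBound Ω (A m) P) :
    ∃ σ : ℕ → ℕ, StrictMono σ ∧ ∃ B, B ⊆ Ω ∧ MeasurableSet B ∧
      Tendsto (fun m => volume.restrict Ω (symmDiff (A (σ m)) B)) atTop (𝓝 0) := by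
  have hfin : IsFiniteMeasure (volume.restrict Ω) :=
    ⟨by rw [Measure.restrict_apply_univ]; exact hΩfin.lt_top⟩
  obtain ⟨σ, hσ, hlim⟩ := exists_subseq_tendsto_measure_inter (volume.restrict Ω) hA
  exact ⟨σ, hσ, exists_limit_set hΩ.measurableSet hΩfin (fun m => hA _) fun ε hε =>
    cauchy_of_translationBound hΩ hΩfin (fun m => hA (σ m)) (fun m => hP (σ m)) hlim hε⟩

/-- A common convergent subsequence for a finite family of sequences of sets. -/
lemma exists_common_subseq_limit_set {ι : Type*} [Finite ι] {Ω : Set (E n)} {P : ℝ≥0}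
    (hΩ : IsOpen Ω) (hΩfin : volume Ω ≠ ⊤) {A : ι → ℕ → Set (E n)}
    (hA : ∀ j m, MeasurableSet (A j m)) (hP : ∀ j m, HasTranslationBound Ω (A j m) P) :
    ∃ σ : ℕ → ℕ, StrictMono σ ∧ ∃ B : ι → Set (E n), ∀ j, B j ⊆ Ω ∧ MeasurableSet (B j) ∧
      Tendsto (fun m => volume.restrict Ω (symmDiff (A j (σ m)) (B j))) atTop (𝓝 0) := by
  classical
  have := Fintype.ofFinite ι
  have key : ∀ J : Finset ι, ∃ σ : ℕ → ℕ, StrictMono σ ∧ ∀ j ∈ J, ∃ B, B ⊆ Ω ∧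
      MeasurableSet B ∧
      Tendsto (fun m => volume.restrict Ω (symmDiff (A j (σ m)) B)) atTop (𝓝 0) := by
    intro J
    induction J using Finset.induction_on with
    | empty => exact ⟨id, strictMono_id, by simp⟩
    | insert i J _ ih =>
      obtain ⟨σ, hσ, h⟩ := ih
      obtain ⟨τ, hτ, B, hB⟩ := exists_subseq_limit_set hΩ hΩfin (fun m => hA i (σ m))
        (fun m => hP i (σ m))
      refine ⟨σ ∘ τ, hσ.comp hτ, fun j hj => ?_⟩
      rcases Finset.mem_insert.1 hj with rfl | hj
      · exact ⟨B, hB⟩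
      · obtain ⟨B', h1, h2, h3⟩ := h j hj
        exact ⟨B', h1, h2, h3.comp hτ.tendsto_atTop⟩
  obtain ⟨σ, hσ, h⟩ := key Finset.univ
  choose B hB using fun j => h j (Finset.mem_univ j)
  exact ⟨σ, hσ, B, hB⟩

/-- Lower semicontinuity of the perimeter under convergence in `L¹(Ω)`. -/
lemma perimeter_le_of_tendsto {Ω B : Set (E n)} {P : ℝ≥0∞}
    (hΩfin : volume Ω ≠ ⊤) {A : ℕ → Set (E n)}
    (hA : ∀ m, MeasurableSet (A m)) (hB : MeasurableSet B)
    (hP : ∀ᶠ m in atTop, perimeter Ω (A m) ≤ P)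
    (hlim : Tendsto (fun m => volume.restrict Ω (symmDiff (A m) B)) atTop (𝓝 0)) :
    perimeter Ω B ≤ P := by
  have hfin : IsFiniteMeasure (volume.restrict Ω) :=
    ⟨by rw [Measure.restrict_apply_univ]; exact hΩfin.lt_top⟩
  refine iSup₂_le fun φ hφ => ?_
  obtain ⟨hφ1, hφc, hφΩ, -⟩ := id hφ
  have hcont := continuous_divergence hφ1
  have hcs : HasCompactSupport (divergence φ) :=
    HasCompactSupport.intro hφc fun x hx => divergence_eq_zero_of_notMem hx
  have hint : Integrable (divergence φ) := hcont.integrable_of_hasCompactSupport hcs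
  obtain ⟨M, hM⟩ := hcont.bounded_above_of_compact_support hcs
  have hloc : ∀ C, MeasurableSet C → ∫ x in C, divergence φ x
      = ∫ x in Ω, C.indicator (divergence φ) x := by
    intro C hC
    rw [← integral_indicator hC, setIntegral_eq_integral_of_forall_compl_eq_zero]
    intro x hx
    by_cases hxC : x ∈ C
    · rw [Set.indicator_of_mem hxC]
      exact divergence_eq_zero_of_notMem fun h => hx (hφΩ h)
    · exact Set.indicator_of_notMem hxC _
  have hdiff : ∀ m, |(∫ x in A m, divergence φ x) - ∫ x in B, divergence φ x|
      ≤ M * (volume.restrict Ω).real (symmDiff (A m) B) := by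
    intro m
    rw [hloc _ (hA m), hloc _ hB, ← integral_sub
      (hint.integrableOn.indicator (hA m)) (hint.integrableOn.indicator hB), ← Real.norm_eq_abs,
      ← smul_eq_mul M, smul_eq_mul, mul_comm, ← smul_eq_mul,
      ← integral_indicator_const M ((hA m).symmDiff hB)]
    refine norm_integral_le_of_norm_le ?_ (Eventually.of_forall fun x => ?_)
    · exact (integrable_const M).indicator ((hA m).symmDiff hB)
    · have hMx := hM x
      have hM0 : 0 ≤ M := (norm_nonneg _).trans hMx
      by_cases h1 : x ∈ A m <;> by_cases h2 : x ∈ B <;>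
        simp [Set.mem_symmDiff, Set.indicator, h1, h2] <;> simpa using hMx
  have hconv : Tendsto (fun m => ∫ x in A m, divergence φ x) atTop
      (𝓝 (∫ x in B, divergence φ x)) := by
    rw [tendsto_iff_norm_sub_tendsto_zero]
    have h1 : Tendsto (fun m => M * (volume.restrict Ω).real (symmDiff (A m) B)) atTop (𝓝 0) := by
      have := (ENNReal.tendsto_toReal ENNReal.zero_ne_top).comp hlim
      simpa [Function.comp_def, Measure.real] using this.const_mul M
    exact squeeze_zero (fun _ => norm_nonneg _) hdiff h1
  refine le_of_tendsto (ENNReal.tendsto_ofReal hconv) ?_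
  filter_upwards [hP] with m hm
  exact (le_iSup₂ (f := fun (φ : E n → E n) (_ : φ ∈ {φ : E n → E n | ContDiff ℝ 1 φ ∧
    HasCompactSupport φ ∧ tsupport φ ⊆ Ω ∧ ∀ x, ‖φ x‖ ≤ 1}) =>
    ENNReal.ofReal (∫ x in A m, divergence φ x)) φ hφ).trans hm

end Compactness

/-! ### Convex geometry of the tetrahedra -/

section Geometry

variable {n : ℕ}

/-- The thickening of a convex body that contains a ball of radius `r` is contained in a dilation
about the centre of that ball. -/
lemma subset_homothety {B : Set (E n)} (hB : Convex ℝ B) {z : E n} {r t : ℝ} (hr : 0 < r)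
    (ht : 0 ≤ t) (hz : Metric.closedBall z r ⊆ B) :
    {x | ∃ y ∈ B, ‖x - y‖ ≤ t} ⊆ AffineMap.homothety z (1 + t / r) '' B := by
  rintro x ⟨y, hy, hxy⟩
  have hs : 0 < 1 + t / r := by positivity
  refine ⟨AffineMap.homothety z (1 + t / r)⁻¹ x, ?_, ?_⟩
  · rcases ht.eq_or_lt with rfl | ht
    · have : x = y := by simpa [sub_eq_zero] using hxy
      simpa [this] using hy
    · have hw : z + (r / t) • (x - y) ∈ B := by
        refine hz ?_
        rw [Metric.mem_closedBall, dist_eq_norm, add_sub_cancel_left, norm_smul,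
          Real.norm_of_nonneg (by positivity)]
        calc r / t * ‖x - y‖ ≤ r / t * t := by gcongr
          _ = r := by field_simp
      have hrt : 0 < r + t := by positivity
      have := hB hy hw (a := r / (r + t)) (b := t / (r + t)) (by positivity) (by positivity)
        (by field_simp)
      convert this using 1
      rw [AffineMap.homothety_apply]
      have h1 : (1 + t / r)⁻¹ = r / (r + t) := by field_simp
      have h2 : t / (r + t) = 1 - r / (r + t) := by field_simp; ring
      have h3 : (t / (r + t)) * (r / t) = r / (r + t) := by field_simp
      rw [h1, smul_add, smul_smul, h3, h2]
      simp only [vsub_eq_sub, vadd_eq_add, smul_sub, sub_smul, one_smul]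
      abel
  · simp only [AffineMap.homothety_apply, vsub_eq_sub, vadd_eq_add, add_sub_cancel_right,
      smul_inv_smul₀ hs.ne', sub_add_cancel]

/-- The shell of thickness `t` around `B`: the points outside `B` with distance at most `t` to a
point of `B`. -/
def shell (B : Set (E n)) (t : ℝ) : Set (E n) := {x | x ∉ B ∧ ∃ y ∈ B, ‖x - y‖ ≤ t}

lemma one_add_pow_le {s : ℝ} (hs : 0 ≤ s) (hs1 : s ≤ 1) (n : ℕ) :
    (1 + s) ^ n ≤ 1 + 2 ^ n * s := by
  have key : (1 + s) ^ n ≤ 1 + (2 ^ n - 1) * s := by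
    induction n with
    | zero => simp
    | succ n ih =>
      have h2 : (0 : ℝ) ≤ 2 ^ n - 1 := sub_nonneg.2 (one_le_pow₀ (by norm_num))
      calc (1 + s) ^ (n + 1) = (1 + s) ^ n * (1 + s) := pow_succ _ _
        _ ≤ (1 + (2 ^ n - 1) * s) * (1 + s) := by gcongr
        _ ≤ 1 + (2 ^ (n + 1) - 1) * s := by
          rw [pow_succ]
          nlinarith [mul_nonneg (mul_nonneg (sub_nonneg.2 hs1) hs) h2]
  linarith

/-- The volume of a shell of thickness `t ≤ r` is at most of order `t / r` times the volume. -/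
lemma volume_shell_le {B : Set (E n)} (hB : Convex ℝ B) (hBc : IsCompact B) {z : E n} {r t : ℝ}
    (hr : 0 < r) (ht : 0 ≤ t) (htr : t ≤ r) (hz : Metric.closedBall z r ⊆ B) :
    volume (shell B t) ≤ ENNReal.ofReal (2 ^ n * (t / r)) * volume B := by
  have hBm := hBc.measurableSet
  have hBf : volume B ≠ ⊤ := hBc.measure_lt_top.ne
  have h1 : volume (shell B t) + volume B
      ≤ ENNReal.ofReal (2 ^ n * (t / r)) * volume B + volume B := by
    have hd : Disjoint (shell B t) B := Set.disjoint_left.2 fun x hx => hx.1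
    rw [← measure_union hd hBm]
    calc volume (shell B t ∪ B) ≤ volume (AffineMap.homothety z (1 + t / r) '' B) := by
          refine measure_mono (subset_trans ?_ (subset_homothety hB hr ht hz))
          rintro x (hx | hx)
          · exact hx.2
          · exact ⟨x, hx, by simpa using ht⟩
      _ = ENNReal.ofReal ((1 + t / r) ^ n) * volume B := by
          rw [Measure.addHaar_image_homothety, finrank_euclideanSpace_fin,
            abs_of_nonneg (by positivity)]
      _ ≤ ENNReal.ofReal (1 + 2 ^ n * (t / r)) * volume B := by
          gcongr
          exact one_add_pow_le (by positivity) ((div_le_one hr).2 htr) n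
      _ = _ := by
          rw [add_comm, ENNReal.ofReal_add (by positivity) zero_le_one, ENNReal.ofReal_one,
            add_mul, one_mul]
  exact (ENNReal.add_le_add_iff_right hBf).1 h1

lemma finrank_vectorSpan_add_one_le {g : Finset (E n)} (hg : g.Nonempty) :
    Module.finrank ℝ (vectorSpan ℝ (g : Set (E n))) + 1 ≤ g.card := by
  classical
  obtain ⟨m, hm⟩ : ∃ m, g.card = m + 1 :=
    ⟨g.card - 1, (Nat.succ_pred_eq_of_pos (Finset.card_pos.2 hg)).symm⟩
  have := finrank_vectorSpan_image_finset_le ℝ (id : E n → E n) g hm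
  rw [Finset.coe_image, Set.image_id] at this
  omega

/-- The lines parallel to `h` through the convex hull of fewer than `n` points lie in an affine
subspace of dimension at most `n - 1`, so they form a null set. -/
lemma volume_segment_meets_eq_zero {g : Finset (E n)} (hg : g.card < n) (h : E n) :
    volume {x | (segment ℝ (x - h) x ∩ convexHull ℝ (g : Set (E n))).Nonempty} = 0 := by
  rcases g.eq_empty_or_nonempty with rfl | ⟨g₀, hg₀⟩
  · simp
  let W : Submodule ℝ (E n) := vectorSpan ℝ (g : Set (E n)) ⊔ (ℝ ∙ h)
  have hW : Module.finrank ℝ W < n := by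
    have h1 := finrank_vectorSpan_add_one_le ⟨g₀, hg₀⟩
    have h2 := Submodule.finrank_add_le_finrank_add_finrank (vectorSpan ℝ (g : Set (E n))) (ℝ ∙ h)
    have h3 : Module.finrank ℝ (ℝ ∙ h) ≤ 1 := (finrank_span_le_card {h}).trans (by simp)
    change Module.finrank ℝ ↥(vectorSpan ℝ (g : Set (E n)) ⊔ (ℝ ∙ h)) < n
    omega
  have hne : AffineSubspace.mk' g₀ W ≠ ⊤ := by
    intro htop
    have h1 : (AffineSubspace.mk' g₀ W).direction = ⊤ := by
      rw [htop, AffineSubspace.direction_top]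
    rw [AffineSubspace.direction_mk'] at h1
    rw [h1, finrank_top, finrank_euclideanSpace_fin] at hW
    exact lt_irrefl _ hW
  refine measure_mono_null ?_ (Measure.addHaar_affineSubspace volume _ hne)
  rintro x ⟨y, hy, hyg⟩
  have hyv : y - g₀ ∈ vectorSpan ℝ (g : Set (E n)) :=
    vsub_mem_vectorSpan_of_mem_spanPoints_of_mem_spanPoints ℝ
      (convexHull_subset_affineSpan _ hyg) (subset_affineSpan ℝ _ hg₀)
  obtain ⟨a, b, ha, hb, hab, rfl⟩ := hy
  rw [SetLike.mem_coe, AffineSubspace.mem_mk', vsub_eq_sub]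
  have hx : x - g₀ = (a • (x - h) + b • x - g₀) + a • h := by
    have : x = (a + b) • x := by rw [hab, one_smul]
    nth_rewrite 1 [this]
    rw [add_smul, smul_sub]; abel
  rw [hx]
  exact Submodule.add_mem_sup hyv (Submodule.smul_mem _ _ (Submodule.mem_span_singleton_self h))

lemma volume_convexHull_eq_zero {g : Finset (E n)} (hg : g.card ≤ n) :
    volume (convexHull ℝ (g : Set (E n))) = 0 := by
  rcases g.eq_empty_or_nonempty with rfl | hne
  · simp
  refine measure_mono_null (convexHull_subset_affineSpan _)
    (Measure.addHaar_affineSubspace volume _ fun htop => ?_)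
  have h1 := finrank_vectorSpan_add_one_le hne
  rw [← direction_affineSpan, htop, AffineSubspace.direction_top, finrank_top,
    finrank_euclideanSpace_fin] at h1
  omega

variable {T : Geometry.SimplicialComplex ℝ (E n)} {s t : Finset (E n)}

lemma isCompact_tet (s : Finset (E n)) : IsCompact (convexHull ℝ (s : Set (E n))) :=
  s.finite_toSet.isCompact_convexHull ℝ

/-- The vertices of a tetrahedron form an affine basis. -/
def tetBasis (hs : s ∈ tets T) : AffineBasis s ℝ (E n) where
  toFun := (↑)
  ind' := T.indep hs.1
  tot' := by
    rw [(T.indep hs.1).affineSpan_eq_top_iff_card_eq_finrank_add_one, Fintype.card_coe, hs.2,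
      finrank_euclideanSpace_fin]

@[simp] lemma tetBasis_apply (hs : s ∈ tets T) (i : s) : tetBasis hs i = (i : E n) := rfl

lemma range_tetBasis (hs : s ∈ tets T) : Set.range (tetBasis hs) = (s : Set (E n)) := by
  ext x; simp

lemma mem_tet_iff (hs : s ∈ tets T) {x : E n} :
    x ∈ convexHull ℝ (s : Set (E n)) ↔ ∀ i, 0 ≤ (tetBasis hs).coord i x := by
  rw [← range_tetBasis hs, AffineBasis.convexHull_eq_nonneg_coord]; rfl

lemma interior_tet_nonempty (hs : s ∈ tets T) :
    (interior (convexHull ℝ (s : Set (E n)))).Nonempty := by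
  rw [← range_tetBasis hs]
  exact ⟨_, (tetBasis hs).centroid_mem_interior_convexHull⟩

lemma volume_tet_ne_zero (hs : s ∈ tets T) : volume (convexHull ℝ (s : Set (E n))) ≠ 0 :=
  ((isOpen_interior.measure_pos volume (interior_tet_nonempty hs)).trans_le
    (measure_mono interior_subset)).ne'

lemma card_inter_le (hs : s ∈ tets T) (ht : t ∈ tets T) (hst : s ≠ t) [DecidableEq (E n)] :
    (s ∩ t).card ≤ n := by
  by_contra! hlt
  have h1 : s ∩ t = s := Finset.eq_of_subset_of_card_le Finset.inter_subset_left (by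
    rw [hs.2]; omega)
  have h2 : s ∩ t = t := Finset.eq_of_subset_of_card_le Finset.inter_subset_right (by
    rw [ht.2]; omega)
  exact hst (h1.symm.trans h2)

lemma inter_tet_subset (hs : s ∈ tets T) (ht : t ∈ tets T) [DecidableEq (E n)] :
    convexHull ℝ (s : Set (E n)) ∩ convexHull ℝ (t : Set (E n))
      ⊆ convexHull ℝ ((s ∩ t : Finset (E n)) : Set (E n)) := by
  rw [Finset.coe_inter]
  exact T.inter_subset_convexHull hs.1 ht.1

lemma volume_inter_tet_eq_zero (hs : s ∈ tets T) (ht : t ∈ tets T) (hst : s ≠ t) :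
    volume (convexHull ℝ (s : Set (E n)) ∩ convexHull ℝ (t : Set (E n))) = 0 := by
  classical
  exact measure_mono_null (inter_tet_subset hs ht)
    (volume_convexHull_eq_zero (card_inter_le hs ht hst))

lemma disjoint_interior_tet (hs : s ∈ tets T) (ht : t ∈ tets T) (hst : s ≠ t) :
    Disjoint (interior (convexHull ℝ (s : Set (E n))))
      (interior (convexHull ℝ (t : Set (E n)))) := by
  rw [Set.disjoint_iff_inter_eq_empty, ← (isOpen_interior.inter isOpen_interior).measure_eq_zero_iff
    (volume : Measure (E n))]
  exact measure_mono_null (Set.inter_subset_inter interior_subset interior_subset)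
    (volume_inter_tet_eq_zero hs ht hst)

lemma volume_interior_tet (s : Finset (E n)) :
    volume (interior (convexHull ℝ (s : Set (E n)))) = volume (convexHull ℝ (s : Set (E n))) :=
  measure_congr (interior_ae_eq_of_null_frontier
    (Convex.addHaar_frontier volume (convex_convexHull ℝ _)))

lemma exists_closedBall_subset_tet {c C : ℝ} {m : ℕ} (hc : 0 < c) (hm : 1 ≤ m)
    (hnd : IsNondegenerate T c C m) (hs : s ∈ tets T) :
    ∃ z, Metric.closedBall z (c / (2 * m)) ⊆ convexHull ℝ (s : Set (E n)) := by
  have hm' : (0 : ℝ) < m := by exact_mod_cast hm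
  have hlt : c / (2 * m) < inradius (convexHull ℝ (s : Set (E n))) := by
    refine lt_of_lt_of_le ?_ (hnd s hs).1
    gcongr
    linarith
  obtain ⟨r, ⟨z, hz⟩, hr⟩ := exists_lt_of_lt_csSup
    (show Set.Nonempty {r | ∃ x, Metric.closedBall x r ⊆ convexHull ℝ (s : Set (E n))} from
      -- a ball of negative radius is empty
      ⟨-1, 0, by rw [Metric.closedBall_eq_empty.2 (by norm_num)]; exact Set.empty_subset _⟩) hlt
  exact ⟨z, (Metric.closedBall_subset_closedBall hr.le).trans hz⟩

lemma finite_tets {Ω : Set (E n)} (hΩb : Bornology.IsBounded Ω) (hT : IsTriangulation T Ω)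
    {c C : ℝ} {m : ℕ} (hc : 0 < c) (hm : 1 ≤ m) (hnd : IsNondegenerate T c C m) :
    (tets T).Finite := by
  have hm' : (0 : ℝ) < m := by exact_mod_cast hm
  have hpos : 0 < volume (Metric.closedBall (0 : E n) (c / (2 * m))) :=
    Metric.measure_closedBall_pos volume _ (by positivity)
  have hfin := Measure.finite_const_le_meas_of_disjoint_iUnion volume hpos
    (As := fun s : tets T => interior (convexHull ℝ ((s : Finset (E n)) : Set (E n))))
    (fun s => isOpen_interior.measurableSet)
    (fun s t hst => disjoint_interior_tet s.2 t.2 (Subtype.coe_injective.ne hst))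
    (ne_top_of_le_ne_top hΩb.measure_lt_top.ne
      (measure_mono (Set.iUnion_subset fun s => hT.subset s s.2)))
  have huniv : {s : tets T | volume (Metric.closedBall (0 : E n) (c / (2 * m)))
      ≤ volume (interior (convexHull ℝ ((s : Finset (E n)) : Set (E n))))} = Set.univ := by
    refine Set.eq_univ_of_forall fun s => ?_
    obtain ⟨z, hz⟩ := exists_closedBall_subset_tet hc hm hnd s.2
    have h1 := measure_mono (μ := volume) hz
    rwa [Measure.addHaar_closedBall_center, ← volume_interior_tet] at h1
  rw [huniv, Set.finite_univ_iff] at hfin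
  exact Set.toFinite _

end Geometry

/-! ### Two tetrahedra near a point of their common facet -/

section Facet

variable {n : ℕ} {T : Geometry.SimplicialComplex ℝ (E n)} {s t : Finset (E n)}

/-- A point of a tetrahedron lies in the convex hull of the vertices at which its barycentric
coordinate does not vanish. -/
lemma mem_convexHull_of_coord_ne_zero (hs : s ∈ tets T) {y : E n}
    (hy : y ∈ convexHull ℝ (s : Set (E n))) {g : Finset (E n)}
    (hg : ∀ i : s, (tetBasis hs).coord i y ≠ 0 → (i : E n) ∈ g) :
    y ∈ convexHull ℝ (g : Set (E n)) := by
  classical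
  have h1 := (tetBasis hs).linear_combination_coord_eq_self y
  have h2 : ∑ i ∈ Finset.univ.filter (fun i : s => (tetBasis hs).coord i y ≠ 0),
      (tetBasis hs).coord i y • (i : E n) = y := by
    rw [Finset.sum_filter_of_ne]
    · exact h1
    · intro i _ hi h0
      exact hi (by rw [h0, zero_smul])
  rw [← h2]
  refine (convex_convexHull ℝ _).sum_mem (fun i _ => (mem_tet_iff hs).1 hy i) ?_ fun i hi =>
    subset_convexHull ℝ _ (hg i (Finset.mem_filter.1 hi).2)
  rw [Finset.sum_filter_ne_zero]
  exact (tetBasis hs).sum_coord_apply_eq_one y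

lemma coord_eq_zero_of_mem (hs : s ∈ tets T) {f : Finset (E n)} (hf : f ⊆ s) {i : s}
    (hi : (i : E n) ∉ f) {y : E n} (hy : y ∈ convexHull ℝ (f : Set (E n))) :
    (tetBasis hs).coord i y = 0 := by
  have hconv : Convex ℝ ((tetBasis hs).coord i ⁻¹' {0}) :=
    (convex_singleton (0 : ℝ)).affine_preimage _
  refine convexHull_min ?_ hconv hy
  intro x hx
  have hne : i ≠ ⟨x, hf hx⟩ := fun h => hi (by rw [h]; exact hx)
  have := (tetBasis hs).coord_apply_ne hne
  simpa using this

lemma eq_of_mem_of_notMem_facet {f : Finset (E n)} (hs : s.card = n + 1) (hfs : f ⊆ s)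
    (hf : f.card = n) {p x : E n} (hps : p ∈ s) (hpf : p ∉ f) (hxs : x ∈ s) (hxf : x ∉ f) :
    x = p := by
  classical
  have h1 : (s \ f).card = 1 := by rw [Finset.card_sdiff_of_subset hfs]; omega
  obtain ⟨q, hq⟩ := Finset.card_eq_one.1 h1
  have h2 : x ∈ s \ f := Finset.mem_sdiff.2 ⟨hxs, hxf⟩
  have h3 : p ∈ s \ f := Finset.mem_sdiff.2 ⟨hps, hpf⟩
  rw [hq, Finset.mem_singleton] at h2 h3
  rw [h2, h3]

/-- Near a relatively interior point `y` of its facet `f`, a tetrahedron is given by the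
barycentric coordinate of the vertex opposite to `f`. -/
lemma eventually_mem_tet_iff (hs : s ∈ tets T) {f : Finset (E n)} (hfs : f ⊆ s)
    (hf : f.card = n) {y : E n} (hy : y ∈ convexHull ℝ (f : Set (E n)))
    (hskel : ∀ g : Finset (E n), g ⊆ s → g.card < n → y ∉ convexHull ℝ (g : Set (E n)))
    {p : s} (hp : (p : E n) ∉ f) :
    ∀ᶠ x in 𝓝 y, x ∈ convexHull ℝ (s : Set (E n)) ↔ 0 ≤ (tetBasis hs).coord p x := by
  classical
  have hys : y ∈ convexHull ℝ (s : Set (E n)) := convexHull_mono (by exact_mod_cast hfs) hy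
  have hpos : ∀ i : s, (i : E n) ∈ f → 0 < (tetBasis hs).coord i y := by
    intro i hi
    refine lt_of_le_of_ne ((mem_tet_iff hs).1 hys i) fun h0 => ?_
    refine hskel (f.erase i) ((Finset.erase_subset _ _).trans hfs) ?_ ?_
    · rw [Finset.card_erase_of_mem hi, hf]
      have := Finset.card_pos.2 ⟨_, hi⟩
      omega
    · refine mem_convexHull_of_coord_ne_zero hs hys fun j hj => ?_
      refine Finset.mem_erase.2 ⟨fun h => hj ?_, ?_⟩
      · rw [Subtype.ext h, ← h0]
      · by_contra hjf
        exact hj (coord_eq_zero_of_mem hs hfs hjf hy)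
  have hev : ∀ᶠ x in 𝓝 y, ∀ i : s, (i : E n) ∈ f → 0 < (tetBasis hs).coord i x := by
    rw [eventually_all]
    intro i
    by_cases hi : (i : E n) ∈ f
    · have hc : Continuous ((tetBasis hs).coord i) := AffineMap.continuous_of_finiteDimensional _
      filter_upwards [hc.continuousAt.eventually (lt_mem_nhds (hpos i hi))] with x hx _
      exact hx
    · exact Eventually.of_forall fun x h => absurd h hi
  filter_upwards [hev] with x hx
  rw [mem_tet_iff hs]
  refine ⟨fun h => h p, fun h i => ?_⟩
  by_cases hi : (i : E n) ∈ f
  · exact (hx i hi).le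
  · have : i = p := Subtype.ext (eq_of_mem_of_notMem_facet hs.2 hfs hf p.2 hp i.2 hi)
    rw [this]; exact h

/-- The barycentric coordinates of the opposite vertices, for two tetrahedra with a common facet,
are proportional. -/
lemma coord_eq_mul_coord (hs : s ∈ tets T) (ht : t ∈ tets T) {f : Finset (E n)} (hfs : f ⊆ s)
    (hft : f ⊆ t) (hf : f.card = n) {p : s} (hp : (p : E n) ∉ f) {q : t} (hq : (q : E n) ∉ f)
    (x : E n) :
    (tetBasis ht).coord q x = (tetBasis ht).coord q p * (tetBasis hs).coord p x := by
  classical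
  have h1 := congrArg ((tetBasis ht).coord q) ((tetBasis hs).affineCombination_coord_eq_self x)
  rw [Finset.map_affineCombination _ _ _ ((tetBasis hs).sum_coord_apply_eq_one x),
    Finset.affineCombination_eq_linear_combination _ _ _
      ((tetBasis hs).sum_coord_apply_eq_one x)] at h1
  rw [← h1, Finset.sum_eq_single p]
  · simp [mul_comm]
  · intro i _ hip
    have hif : (i : E n) ∈ f := by
      by_contra hif
      exact hip (Subtype.ext (eq_of_mem_of_notMem_facet hs.2 hfs hf p.2 hp i.2 hif))
    have := coord_eq_zero_of_mem ht hft hq (subset_convexHull ℝ _ hif)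
    simp [this]
  · simp

/-- Near a point outside the `(n - 2)`-dimensional skeleton, two different tetrahedra that contain
the point are the two half-spaces bounded by the hyperplane through their common facet. -/
lemma exists_facet_normal (hs : s ∈ tets T) (ht : t ∈ tets T) (hst : s ≠ t) {y : E n}
    (hys : y ∈ convexHull ℝ (s : Set (E n))) (hyt : y ∈ convexHull ℝ (t : Set (E n)))
    (hskels : ∀ g : Finset (E n), g ⊆ s → g.card < n → y ∉ convexHull ℝ (g : Set (E n)))
    (hskelt : ∀ g : Finset (E n), g ⊆ t → g.card < n → y ∉ convexHull ℝ (g : Set (E n))) :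
    ∃ b : E n, IsInterfaceNormal T b ∧ ∀ᶠ x in 𝓝 y,
      (0 ≤ inner ℝ (x - y) b → x ∈ convexHull ℝ (s : Set (E n))) ∧
      (inner ℝ (x - y) b ≤ 0 → x ∈ convexHull ℝ (t : Set (E n))) := by
  classical
  obtain ⟨f, hfdef⟩ : ∃ f, f = s ∩ t := ⟨_, rfl⟩
  have hfs : f ⊆ s := hfdef ▸ Finset.inter_subset_left
  have hft : f ⊆ t := hfdef ▸ Finset.inter_subset_right
  have hinter := inter_tet_subset hs ht
  rw [← hfdef] at hinter
  have hyf : y ∈ convexHull ℝ (f : Set (E n)) := hinter ⟨hys, hyt⟩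
  have hf : f.card = n := by
    refine le_antisymm (hfdef ▸ card_inter_le hs ht hst) ?_
    by_contra! hlt
    exact hskels f hfs hlt hyf
  obtain ⟨p', hps, hpf'⟩ := Finset.exists_mem_notMem_of_card_lt_card
    (show f.card < s.card by rw [hs.2, hf]; omega)
  obtain ⟨q', hqt, hqf'⟩ := Finset.exists_mem_notMem_of_card_lt_card
    (show f.card < t.card by rw [ht.2, hf]; omega)
  obtain ⟨p, hpf⟩ : ∃ p : s, (p : E n) ∉ f := ⟨⟨p', hps⟩, hpf'⟩
  obtain ⟨q, hqf⟩ : ∃ q : t, (q : E n) ∉ f := ⟨⟨q', hqt⟩, hqf'⟩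
  obtain ⟨lam, hlam⟩ : ∃ lam, lam = (tetBasis hs).coord p := ⟨_, rfl⟩
  obtain ⟨c, hc⟩ : ∃ c, c = (tetBasis ht).coord q p := ⟨_, rfl⟩
  have hzero : ∀ x ∈ convexHull ℝ (f : Set (E n)), lam x = 0 := fun x hx => by
    rw [hlam]; exact coord_eq_zero_of_mem hs hfs (i := p) hpf hx
  have hmus : ∀ x, (tetBasis ht).coord q x = c * lam x := fun x => by
    rw [hlam, hc]; exact coord_eq_mul_coord hs ht hfs hft hf (p := p) hpf (q := q) hqf x
  have hevs : ∀ᶠ x in 𝓝 y, x ∈ convexHull ℝ (s : Set (E n)) ↔ 0 ≤ lam x := by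
    rw [hlam]; exact eventually_mem_tet_iff hs hfs hf hyf hskels (p := p) hpf
  have hevt : ∀ᶠ x in 𝓝 y, x ∈ convexHull ℝ (t : Set (E n)) ↔ 0 ≤ c * lam x := by
    simp only [← hmus]
    exact eventually_mem_tet_iff ht hft hf hyf hskelt (p := q) hqf
  have hc0 : c ≠ 0 := by
    rintro rfl
    have h1 := (tetBasis ht).coord_apply_eq q
    rw [hmus, zero_mul] at h1
    exact zero_ne_one h1
  have hlamp : lam p = 1 := by
    rw [hlam]; exact (tetBasis hs).coord_apply_eq p
  -- `w` is the gradient of the affine function `lam`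
  let w : E n := (InnerProductSpace.toDual ℝ (E n)).symm (LinearMap.toContinuousLinearMap lam.linear)
  have hw : ∀ x z : E n, lam x - lam z = inner ℝ (x - z) w := by
    intro x z
    rw [real_inner_comm, InnerProductSpace.toDual_symm_apply]
    exact (lam.linearMap_vsub x z).symm
  have hlamy : lam y = 0 := hzero y hyf
  have hw' : ∀ x, lam x = inner ℝ (x - y) w := fun x => by rw [← hw, hlamy, sub_zero]
  have hw0 : w ≠ 0 := by
    intro h0
    have := hw' p
    rw [h0, inner_zero_right, hlamp] at this
    exact one_ne_zero this
  have hwpos : 0 < ‖w‖ := norm_pos_iff.2 hw0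
  -- on the same side of the facet, the two tetrahedra would overlap
  have hcneg : c < 0 := by
    by_contra! hcn
    have hlim : Tendsto (fun ε : ℝ => y + ε • w) (𝓝[>] 0) (𝓝 y) := by
      have : Continuous fun ε : ℝ => y + ε • w := by fun_prop
      have h1 := this.tendsto 0
      rw [zero_smul, add_zero] at h1
      exact h1.mono_left nhdsWithin_le_nhds
    obtain ⟨ε, ⟨h1, h2⟩, hε⟩ :=
      ((hlim.eventually (hevs.and hevt)).and self_mem_nhdsWithin).exists
    have hε : (0 : ℝ) < ε := hε
    have hval : lam (y + ε • w) = ε * ‖w‖ ^ 2 := by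
      rw [hw', add_sub_cancel_left, inner_smul_left, real_inner_self_eq_norm_sq]; simp
    have hpos : 0 < lam (y + ε • w) := by rw [hval]; positivity
    have h3 := hzero _ (hinter ⟨h1.2 hpos.le, h2.2 (mul_nonneg hcn hpos.le)⟩)
    linarith
  refine ⟨‖w‖⁻¹ • w, ⟨?_, s, hs, t, ht, hst, f, hfs, hft, hf, ?_⟩, ?_⟩
  · rw [norm_smul, norm_inv, norm_norm, inv_mul_cancel₀ hwpos.ne']
  · intro x hx z hz
    rw [inner_smul_right, ← hw, hzero x (subset_convexHull ℝ _ hx),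
      hzero z (subset_convexHull ℝ _ hz), sub_zero, mul_zero]
  · filter_upwards [hevs, hevt] with x hxs hxt
    rw [inner_smul_right, ← hw', hxs, hxt]
    refine ⟨fun h => ?_, fun h => ?_⟩
    · exact (mul_nonneg_iff_of_pos_left (inv_pos.2 hwpos)).1 h
    · refine mul_nonneg_of_nonpos_of_nonpos hcneg.le ?_
      by_contra! h1
      exact absurd (mul_pos (inv_pos.2 hwpos) h1) (not_lt.2 h)

end Facet

/-! ### The jump condition for piecewise constant gradients -/

section Jump

variable {n : ℕ}

lemma continuous_fderiv_apply {φ : E n → ℝ} (hφ : ContDiff ℝ ∞ φ) (v : E n) :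
    Continuous fun x => fderiv ℝ φ x v :=
  (hφ.continuous_fderiv (by simp)).clm_apply continuous_const

lemma integrable_fderiv_apply {φ : E n → ℝ} (hφ : ContDiff ℝ ∞ φ) (hφc : HasCompactSupport φ)
    (v : E n) : Integrable fun x => fderiv ℝ φ x v :=
  (continuous_fderiv_apply hφ v).integrable_of_hasCompactSupport (hφc.fderiv_apply (𝕜 := ℝ) v)

/-- Integration by parts over a set that is invariant under translations in the direction `v`. -/
lemma setIntegral_fderiv_eq_zero {φ : E n → ℝ} (hφ : ContDiff ℝ ∞ φ) (hφc : HasCompactSupport φ)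
    {S : Set (E n)} (hS : MeasurableSet S) {v : E n} (hv : ∀ x, ∀ a : ℝ, x + a • v ∈ S ↔ x ∈ S) :
    ∫ x in S, fderiv ℝ φ x v = 0 := by
  have hline : ∀ x, HasLineDerivAt ℝ (charFun S) 0 x v := by
    intro x
    have h1 : (fun a : ℝ => charFun S (x + a • v)) = fun _ => charFun S x := by
      ext a
      by_cases hx : x ∈ S
      · simp [charFun, hx, (hv x a).2 hx]
      · simp [charFun, hx, mt (hv x a).1 hx]
    unfold HasLineDerivAt
    rw [h1]
    exact hasDerivAt_const _ _
  have hint := integrable_fderiv_apply hφ hφc v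
  have hφi : Integrable φ := hφ.continuous.integrable_of_hasCompactSupport hφc
  have hind : ∀ g : E n → ℝ, (fun x => ContinuousLinearMap.mul ℝ ℝ (charFun S x) (g x))
      = S.indicator g := by
    intro g; ext x; by_cases hx : x ∈ S <;> simp [charFun, hx]
  have key := integral_bilinear_hasLineDerivAt_right_eq_neg_left_of_integrable
    (μ := (volume : Measure (E n))) (f := charFun S) (f' := fun _ => 0) (g := φ)
    (g' := fun x => fderiv ℝ φ x v) (v := v) (B := ContinuousLinearMap.mul ℝ ℝ)
    (by simp)
    (by rw [hind]; exact hint.indicator hS) (by rw [hind]; exact hφi.indicator hS)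
    (fun x _ => hline x)
    (fun x _ => ((hφ.differentiable (by simp)) x).hasFDerivAt.hasLineDerivAt v)
  rw [hind, integral_indicator hS] at key
  simpa using key

/-- The half-space bounded by the hyperplane through `y` with normal `b`, on the side of `b`. -/
def halfSpace (y b : E n) : Set (E n) := {x | 0 ≤ inner ℝ (x - y) b}

lemma measurableSet_halfSpace (y b : E n) : MeasurableSet (halfSpace y b) :=
  (isClosed_le continuous_const (by fun_prop)).measurableSet

/-- There are test functions supported near `y` whose derivative in the direction `b` has a
nonvanishing integral over the half-space: radially decreasing ones. -/
lemma exists_bump {y b : E n} (hb : ‖b‖ = 1) {ρ : ℝ} (hρ : 0 < ρ) :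
    ∃ φ : E n → ℝ, ContDiff ℝ ∞ φ ∧ HasCompactSupport φ ∧ tsupport φ ⊆ Metric.ball y ρ ∧
      ∫ x in halfSpace y b, fderiv ℝ φ x b ≠ 0 := by
  let r : ℝ := ρ / 2
  have hr : 0 < r := by positivity
  let φ : E n → ℝ := fun x => expNegInvGlue (r ^ 2 - ‖x - y‖ ^ 2)
  have hsmooth : ContDiff ℝ ∞ φ := by
    refine expNegInvGlue.contDiff.comp ?_
    exact contDiff_const.sub ((contDiff_id.sub contDiff_const).norm_sq ℝ)
  have hsupp : tsupport φ ⊆ Metric.closedBall y r := by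
    refine closure_minimal (fun x hx => ?_) Metric.isClosed_closedBall
    rw [Metric.mem_closedBall, dist_eq_norm]
    by_contra! hlt
    refine hx (expNegInvGlue.zero_of_nonpos ?_)
    have := pow_lt_pow_left₀ hlt hr.le two_ne_zero
    linarith
  have hcs : HasCompactSupport φ :=
    (isCompact_closedBall y r).of_isClosed_subset (isClosed_tsupport φ) hsupp
  have hderiv : ∀ x, fderiv ℝ φ x b
      = deriv expNegInvGlue (r ^ 2 - ‖x - y‖ ^ 2) * (-(2 * inner ℝ (x - y) b)) := by
    intro x
    have h1 : HasFDerivAt (fun x : E n => r ^ 2 - ‖x - y‖ ^ 2)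
        (-(2 • (innerSL ℝ (x - y)))) x := by
      have h2 := ((hasFDerivAt_id x).sub_const y).norm_sq
      simpa using h2.const_sub (r ^ 2)
    have hd : DifferentiableAt ℝ expNegInvGlue (r ^ 2 - ‖x - y‖ ^ 2) :=
      (expNegInvGlue.contDiff (n := 1)).differentiable one_ne_zero _
    have h3 : fderiv ℝ φ x = deriv expNegInvGlue (r ^ 2 - ‖x - y‖ ^ 2) •
        (-(2 • (innerSL ℝ (x - y))) : E n →L[ℝ] ℝ) :=
      (HasDerivAt.comp_hasFDerivAt (h₂ := expNegInvGlue) x hd.hasDerivAt h1).fderiv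
    rw [h3]
    simp [inner_sub_left]
  have hmono : Monotone expNegInvGlue := by
    intro a c hac
    rcases le_or_gt a 0 with ha | ha
    · rw [expNegInvGlue.zero_of_nonpos ha]; exact expNegInvGlue.nonneg c
    · have hc : 0 < c := ha.trans_le hac
      simp only [expNegInvGlue, not_le.2 ha, not_le.2 hc, if_false]
      gcongr
  have hneg : ∀ x ∈ halfSpace y b, fderiv ℝ φ x b ≤ 0 := by
    intro x hx
    have hx' : 0 ≤ inner ℝ (x - y) b := hx
    rw [hderiv]
    exact mul_nonpos_of_nonneg_of_nonpos hmono.deriv_nonneg (by linarith)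
  refine ⟨φ, hsmooth, hcs, hsupp.trans (Metric.closedBall_subset_ball (half_lt_self hρ)),
    fun h0 => ?_⟩
  -- the derivative would vanish on the open half-space, so `φ` is constant along the ray `y + s b`
  have hae : ∀ᵐ x ∂(volume.restrict (halfSpace y b)), -fderiv ℝ φ x b = 0 := by
    have h1 : ∫ x in halfSpace y b, -fderiv ℝ φ x b = 0 := by rw [integral_neg, h0, neg_zero]
    refine (setIntegral_eq_zero_iff_of_nonneg_ae ?_
      (integrable_fderiv_apply hsmooth hcs b).neg.integrableOn).1 h1
    filter_upwards [ae_restrict_mem (measurableSet_halfSpace y b)] with x hx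
    simpa using hneg x hx
  have hopen : IsOpen {x : E n | 0 < inner ℝ (x - y) b} :=
    isOpen_lt continuous_const (by fun_prop)
  have hae' : (fun x => fderiv ℝ φ x b) =ᵐ[volume.restrict {x : E n | 0 < inner ℝ (x - y) b}]
      fun _ => 0 := by
    have hsub : {x : E n | 0 < inner ℝ (x - y) b} ⊆ halfSpace y b := fun x hx =>
      (show (0 : ℝ) < inner ℝ (x - y) b from hx).le
    filter_upwards [ae_mono (Measure.restrict_mono hsub le_rfl) hae] with x hx
    simpa using hx
  have heq := Measure.eqOn_open_of_ae_eq hae' hopen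
    (continuous_fderiv_apply hsmooth b).continuousOn continuousOn_const
  let ψ : ℝ → ℝ := fun a => φ (y + a • b)
  have hψ : ∀ a, HasDerivAt ψ (fderiv ℝ φ (y + a • b) b) a := by
    intro a
    have h1 : HasDerivAt (fun a : ℝ => y + a • b) b a := by
      simpa using ((hasDerivAt_id a).smul_const b).const_add y
    exact ((hsmooth.differentiable (by simp)) _).hasFDerivAt.comp_hasDerivAt a h1
  obtain ⟨a, ha, hslope⟩ := exists_hasDerivAt_eq_slope ψ _ hr
    (fun a _ => (hψ a).continuousAt.continuousWithinAt) (fun a _ => hψ a)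
  have hin : y + a • b ∈ {x : E n | 0 < inner ℝ (x - y) b} := by
    change 0 < inner ℝ (y + a • b - y) b
    rw [add_sub_cancel_left, inner_smul_left, real_inner_self_eq_norm_sq, hb]
    simpa using ha.1
  rw [show fderiv ℝ φ (y + a • b) b = 0 from heq hin] at hslope
  have e1 : ψ r = 0 := by
    simp only [ψ, φ, add_sub_cancel_left, norm_smul, hb, mul_one, Real.norm_eq_abs, sq_abs,
      sub_self, expNegInvGlue.zero]
  have e2 : 0 < ψ 0 := by
    simp only [ψ, φ, zero_smul, add_zero, sub_self, norm_zero]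
    refine expNegInvGlue.pos_of_pos ?_
    have : 0 < r ^ 2 := pow_pos hr 2
    simpa using this
  rw [e1] at hslope
  have : (0 - ψ 0) / (r - 0) < 0 := div_neg_of_neg_of_pos (by linarith) (by linarith)
  linarith

/-- The rows of a weak gradient are curl free, in the weak sense. -/
lemma IsW1InftyWithGradient.curl_free {Ω : Set (E n)} {u : E n → E n} {G : E n → Mat n}
    (hu : IsW1InftyWithGradient Ω u G) {φ : E n → ℝ} (hφ : ContDiff ℝ ∞ φ)
    (hφc : HasCompactSupport φ) (hφΩ : tsupport φ ⊆ Ω) (i j l : Fin n) :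
    ∫ x in Ω, G x i j * partialDeriv l φ x = ∫ x in Ω, G x i l * partialDeriv j φ x := by
  have hsm : ∀ l : Fin n, ContDiff ℝ ∞ (partialDeriv l φ) := fun l =>
    (hφ.fderiv_right (m := ∞) le_rfl).clm_apply contDiff_const
  have hcs : ∀ l : Fin n, HasCompactSupport (partialDeriv l φ) := fun l =>
    hφc.fderiv_apply (𝕜 := ℝ) _
  have hts : ∀ l : Fin n, tsupport (partialDeriv l φ) ⊆ Ω := fun l =>
    (tsupport_fderiv_apply_subset ℝ _).trans hφΩ
  have hsymm : ∀ x, partialDeriv j (partialDeriv l φ) x = partialDeriv l (partialDeriv j φ) x := by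
    intro x
    have hd : DifferentiableAt ℝ (fderiv ℝ φ) x :=
      (hφ.fderiv_right (m := ∞) le_rfl).differentiable (by simp) x
    have h1 : ∀ a c : Fin n, partialDeriv a (partialDeriv c φ) x
        = fderiv ℝ (fderiv ℝ φ) x (EuclideanSpace.single a 1) (EuclideanSpace.single c 1) := by
      intro a c
      unfold partialDeriv
      rw [fderiv_clm_apply hd (differentiableAt_const _)]
      simp
    rw [h1, h1]
    have h2 : ((2 : ℕ∞) : WithTop ℕ∞) ≤ ((⊤ : ℕ∞) : WithTop ℕ∞) := WithTop.coe_le_coe.2 le_top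
    exact (hφ.contDiffAt.isSymmSndFDerivAt (by simpa using h2)) _ _
  have e1 := hu.weak (partialDeriv l φ) (hsm l) (hcs l) (hts l) i j
  have e2 := hu.weak (partialDeriv j φ) (hsm j) (hcs j) (hts j) i l
  simp only [hsymm] at e1
  linarith

/-- Hadamard's jump condition: if the weak gradient takes the values `M` and `N` on the two sides
of a hyperplane with normal `b`, then `M` and `N` agree on the vectors tangential to it. -/
lemma IsW1InftyWithGradient.tangential_jump {Ω : Set (E n)} {u : E n → E n} {G : E n → Mat n}
    (hΩ : IsOpen Ω) (hu : IsW1InftyWithGradient Ω u G) {y b : E n} (hy : y ∈ Ω) (hb : ‖b‖ = 1)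
    {s t : Finset (E n)} {M N : Mat n} (hM : HasGradientOn G s M) (hN : HasGradientOn G t N)
    (hev : ∀ᶠ x in 𝓝 y, (0 ≤ inner ℝ (x - y) b → x ∈ convexHull ℝ (s : Set (E n))) ∧
      (inner ℝ (x - y) b ≤ 0 → x ∈ convexHull ℝ (t : Set (E n))))
    {τ : E n} (hτ : inner ℝ τ b = 0) :
    Matrix.toEuclideanLin (M - N) τ = 0 := by
  obtain ⟨ρ, hρ, hball⟩ := Metric.eventually_nhds_iff_ball.1 (hev.and (hΩ.mem_nhds hy))
  obtain ⟨φ, hφ, hφc, hφs, hφ0⟩ := exists_bump (y := y) hb hρ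
  let H := halfSpace y b
  have hH : MeasurableSet H := measurableSet_halfSpace y b
  let I : Fin n → ℝ := fun l => ∫ x in H, partialDeriv l φ x
  have hΩs : tsupport φ ⊆ Ω := fun x hx => (hball x (hφs hx)).2
  have hint : ∀ l, Integrable (partialDeriv l φ) := fun l => integrable_fderiv_apply hφ hφc _
  have hcompl : ∀ l, ∫ x in Hᶜ, partialDeriv l φ x = - I l := by
    intro l
    have h1 := integral_add_compl hH (hint l)
    have h2 : ∫ x, partialDeriv l φ x = 0 := by
      have := setIntegral_fderiv_eq_zero hφ hφc MeasurableSet.univ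
        (v := EuclideanSpace.single l 1) (by simp)
      simpa [partialDeriv] using this
    rw [h2] at h1
    linarith
  -- the weak gradient tested against a partial derivative of the bump
  have hval : ∀ i j l, ∫ x in Ω, G x i j * partialDeriv l φ x = (M i j - N i j) * I l := by
    intro i j l
    have hM' : ∀ᵐ x, x ∈ convexHull ℝ (s : Set (E n)) → G x = M :=
      (ae_restrict_iff' (isCompact_tet s).measurableSet).1 hM
    have hN' : ∀ᵐ x, x ∈ convexHull ℝ (t : Set (E n)) → G x = N :=
      (ae_restrict_iff' (isCompact_tet t).measurableSet).1 hN
    have hzero : ∀ x, x ∉ tsupport φ → partialDeriv l φ x = 0 := fun x hx => by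
      have : fderiv ℝ φ x = 0 := by
        by_contra h
        exact hx (support_fderiv_subset ℝ h)
      simp [partialDeriv, this]
    calc ∫ x in Ω, G x i j * partialDeriv l φ x
        = ∫ x, G x i j * partialDeriv l φ x := by
          refine setIntegral_eq_integral_of_forall_compl_eq_zero fun x hx => ?_
          rw [hzero x fun h => hx (hΩs h), mul_zero]
      _ = ∫ x, (H.indicator (fun x => M i j * partialDeriv l φ x) x
            + Hᶜ.indicator (fun x => N i j * partialDeriv l φ x) x) := by
          refine integral_congr_ae ?_
          filter_upwards [hM', hN'] with x hxM hxN
          by_cases hx : x ∈ tsupport φ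
          · by_cases hxH : x ∈ H
            · rw [hxM ((hball x (hφs hx)).1.1 hxH)]
              simp [hxH]
            · rw [hxN ((hball x (hφs hx)).1.2 (not_le.1 hxH).le)]
              simp [hxH]
          · by_cases hxH : x ∈ H <;> simp [hzero x hx, hxH]
      _ = M i j * I l + N i j * ∫ x in Hᶜ, partialDeriv l φ x := by
          rw [integral_add (((hint l).const_mul _).indicator hH)
            (((hint l).const_mul _).indicator hH.compl), integral_indicator hH,
            integral_indicator hH.compl, integral_const_mul, integral_const_mul]
      _ = _ := by rw [hcompl]; ring
  -- every row of `M - N` is thus proportional to the vector `I`, which is normal to `τ`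
  have hcurl : ∀ i j l, (M i j - N i j) * I l = (M i l - N i l) * I j := by
    intro i j l
    rw [← hval, ← hval]
    exact hu.curl_free hφ hφc hΩs i j l
  have hI : ∀ v : E n, ∫ x in H, fderiv ℝ φ x v = ∑ l, v l * I l := by
    intro v
    have h1 : ∀ x, fderiv ℝ φ x v = ∑ l, v l * partialDeriv l φ x := by
      intro x
      have hv : v = ∑ l, v l • EuclideanSpace.single l (1 : ℝ) := by
        ext a; simp [Finset.sum_apply, Pi.single_apply]
      conv_lhs => rw [hv]
      rw [map_sum]
      simp [partialDeriv]
    simp only [h1]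
    rw [integral_finsetSum _ fun l _ => ((hint l).const_mul _).integrableOn]
    simp only [integral_const_mul, I]
  have hIτ : ∑ l, τ l * I l = 0 := by
    rw [← hI]
    refine setIntegral_fderiv_eq_zero hφ hφc hH fun x a => ?_
    change 0 ≤ inner ℝ (x + a • τ - y) b ↔ 0 ≤ inner ℝ (x - y) b
    rw [add_sub_right_comm, inner_add_left, inner_smul_left, hτ]
    simp
  obtain ⟨l, hl⟩ : ∃ l, I l ≠ 0 := by
    by_contra! h0
    refine hφ0 ?_
    rw [hI b]
    simp [h0]
  ext i
  have h1 : (∑ j, (M i j - N i j) * τ j) * I l = 0 := by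
    calc (∑ j, (M i j - N i j) * τ j) * I l
        = ∑ j, ((M i j - N i j) * I l) * τ j := by
          rw [Finset.sum_mul]; exact Finset.sum_congr rfl fun j _ => by ring
      _ = (M i l - N i l) * ∑ j, τ j * I j := by
          rw [Finset.mul_sum]; exact Finset.sum_congr rfl fun j _ => by rw [hcurl]; ring
      _ = 0 := by rw [hIτ, mul_zero]
  have h2 := (mul_eq_zero.1 h1).resolve_right hl
  simpa [Matrix.toLpLin_apply, Matrix.mulVec, dotProduct, sub_mul] using h2

end Jump

/-! ### Good and bad tetrahedra -/

section Regions

variable {n k : ℕ}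

lemma well_nonempty (V : Mat n) : (well V).Nonempty := ⟨V, 1, one_mem _, by simp⟩

lemma isCompact_well (V : Mat n) : IsCompact (well V) := by
  have h : well V = (fun Q : Mat n => Q * V) ''
      {Q : Mat n | Q ∈ Matrix.specialOrthogonalGroup (Fin n) ℝ} := by
    ext M; simp [well, eq_comm]
  rw [h]
  exact isCompact_specialOrthogonalGroup.image (continuous_id.matrix_mul continuous_const)

lemma exists_dist_le_of_infDist_well_le {M V : Mat n} {r : ℝ} (h : Metric.infDist M (well V) ≤ r) :
    ∃ Q ∈ Matrix.specialOrthogonalGroup (Fin n) ℝ, dist M (Q * V) ≤ r := by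
  obtain ⟨A, ⟨Q, hQ, rfl⟩, hA⟩ := (isCompact_well V).exists_infDist_eq_dist (well_nonempty V) M
  exact ⟨Q, hQ, hA ▸ h⟩

lemma exists_infDist_well_le {U : Fin k → Mat n} (hk : 1 ≤ k) {M : Mat n} {r : ℝ}
    (h : Metric.infDist M (wells U) ≤ r) : ∃ j, Metric.infDist M (well (U j)) ≤ r := by
  have hc : IsCompact (wells U) := isCompact_iUnion fun j => isCompact_well (U j)
  have hne : (wells U).Nonempty := by
    obtain ⟨A, hA⟩ := well_nonempty (U ⟨0, hk⟩)
    exact ⟨A, Set.mem_iUnion.2 ⟨_, hA⟩⟩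
  obtain ⟨A, hA, hdist⟩ := hc.exists_infDist_eq_dist hne M
  obtain ⟨j, hj⟩ := Set.mem_iUnion.1 hA
  exact ⟨j, (Metric.infDist_le_dist_of_mem hj).trans (hdist ▸ h)⟩

/-- The tetrahedra whose gradient is close to the well of `V`. -/
def goodTets (T : Geometry.SimplicialComplex ℝ (E n)) (G : E n → Mat n) (V : Mat n) (r : ℝ) :
    Set (Finset (E n)) :=
  {s ∈ tets T | ∃ M, HasGradientOn G s M ∧ Metric.infDist M (well V) ≤ r}

/-- The tetrahedra whose gradient is far from all wells. -/
def badTets (T : Geometry.SimplicialComplex ℝ (E n)) (G : E n → Mat n) (U : Fin k → Mat n)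
    (r : ℝ) : Set (Finset (E n)) :=
  {s ∈ tets T | ∃ M, HasGradientOn G s M ∧ r < Metric.infDist M (wells U)}

lemma mem_wellRegion {T : Geometry.SimplicialComplex ℝ (E n)} {G : E n → Mat n} {V : Mat n}
    {r : ℝ} {x : E n} : x ∈ wellRegion T G V r ↔
      ∃ s ∈ goodTets T G V r, x ∈ convexHull ℝ (s : Set (E n)) := by
  simp only [wellRegion, goodTets, Set.mem_iUnion, exists_prop]

lemma mem_badRegion {T : Geometry.SimplicialComplex ℝ (E n)} {G : E n → Mat n}
    {U : Fin k → Mat n} {r : ℝ} {x : E n} : x ∈ badRegion T G U r ↔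
      ∃ s ∈ badTets T G U r, x ∈ convexHull ℝ (s : Set (E n)) := by
  simp only [badRegion, badTets, Set.mem_iUnion, exists_prop]

variable {T : Geometry.SimplicialComplex ℝ (E n)} {G : E n → Mat n} {U : Fin k → Mat n}

lemma isCompact_wellRegion (hfin : (tets T).Finite) (V : Mat n) (r : ℝ) :
    IsCompact (wellRegion T G V r) :=
  (hfin.subset (Set.sep_subset _ _)).isCompact_biUnion fun s _ => isCompact_tet s

lemma isCompact_badRegion (hfin : (tets T).Finite) (r : ℝ) :
    IsCompact (badRegion T G U r) :=
  (hfin.subset (Set.sep_subset _ _)).isCompact_biUnion fun s _ => isCompact_tet s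

lemma HasGradientOn.unique {s : Finset (E n)} (hs : s ∈ tets T) {M N : Mat n}
    (hM : HasGradientOn G s M) (hN : HasGradientOn G s N) : M = N := by
  have : NeBot (ae (volume.restrict (convexHull ℝ (s : Set (E n))))) :=
    ae_restrict_neBot.2 (volume_tet_ne_zero hs)
  obtain ⟨x, h1, h2⟩ := (hM.and hN).exists
  exact h1.symm.trans h2

lemma ne_of_bad_of_good {r : ℝ} {s t : Finset (E n)} {j : Fin k} (hs : s ∈ badTets T G U r)
    (ht : t ∈ goodTets T G (U j) r) : s ≠ t := by
  rintro rfl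
  obtain ⟨hsT, M, hM, hMr⟩ := hs
  obtain ⟨-, N, hN, hNr⟩ := ht
  rw [hM.unique hsT hN] at hMr
  have := Metric.infDist_le_infDist_of_subset (x := N)
    (Set.subset_iUnion (fun j => well (U j)) j) (well_nonempty (U j))
  exact absurd (this.trans hNr) (not_le.2 hMr)

lemma bad_or_good (hk : 1 ≤ k) {Ω : Set (E n)} {D : Set (Mat n)} {u : E n → E n}
    (hu : IsAdmissible Ω T D u G) (r : ℝ) {s : Finset (E n)} (hs : s ∈ tets T) :
    s ∈ badTets T G U r ∨ ∃ j, s ∈ goodTets T G (U j) r := by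
  obtain ⟨M, -, hM⟩ := hu.piecewise s hs
  rcases lt_or_ge r (Metric.infDist M (wells U)) with h | h
  · exact Or.inl ⟨hs, M, hM, h⟩
  · obtain ⟨j, hj⟩ := exists_infDist_well_le hk h
    exact Or.inr ⟨j, hs, M, hM, hj⟩

/-- A tetrahedron cannot be close to two different wells, as these have distance at least `d`. -/
lemma not_good_of_good {d r : ℝ} (hsep : WellsSeparated U d) (hr : 2 * r < d) {i j : Fin k}
    (hij : i ≠ j) {s : Finset (E n)} (hi : s ∈ goodTets T G (U i) r) :
    s ∉ goodTets T G (U j) r := by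
  rintro ⟨hsT, N, hN, hNr⟩
  obtain ⟨-, M, hM, hMr⟩ := hi
  rw [← hM.unique hsT hN] at hNr
  obtain ⟨Q, hQ, h1⟩ := exists_dist_le_of_infDist_well_le hMr
  obtain ⟨R, hR, h2⟩ := exists_dist_le_of_infDist_well_le hNr
  have h3 := hsep i j hij _ ⟨Q, hQ, rfl⟩ _ ⟨R, hR, rfl⟩
  have h4 := dist_triangle_left (Q * U i) (R * U j) M
  linarith

lemma exists_orthonormal_tangential {b : E n} (hb : ‖b‖ = 1) :
    ∃ τ : Fin (n - 1) → E n, Orthonormal ℝ τ ∧ ∀ l, inner ℝ (τ l) b = 0 := by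
  have hb0 : b ≠ 0 := by rintro rfl; simp at hb
  have hn : Module.finrank ℝ (ℝ ∙ b)ᗮ = n - 1 := by
    have := Submodule.finrank_add_finrank_orthogonal (ℝ ∙ b)
    rw [finrank_span_singleton hb0, finrank_euclideanSpace_fin] at this
    omega
  let B := (stdOrthonormalBasis ℝ (ℝ ∙ b)ᗮ).reindex (finCongr hn)
  refine ⟨fun l => (B l : E n), B.orthonormal.comp_linearIsometry (Submodule.subtypeₗᵢ _),
    fun l => ?_⟩
  exact Submodule.mem_orthogonal_singleton_iff_inner_left.1 (B l).2

/-- Tetrahedra that are close to different wells do not meet inside `Ω`, except possibly on the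
`(n - 2)`-dimensional skeleton: their common facet would have an incompatible normal, and the
tangential gap excludes that the gradients agree tangentially. -/
lemma not_adjacent {Ω : Set (E n)} {D : Set (Mat n)} {u : E n → E n} (hΩ : IsOpen Ω)
    (hu : IsAdmissible Ω T D u G) {δ₀ : ℝ}
    (hinc : ∀ b, IsInterfaceNormal T b → IsIncompatibleNormal U δ₀ b) {dbar r : ℝ}
    (hgap : HasTangentialGap U δ₀ dbar) (hr : 2 * r < dbar) {i j : Fin k} (hij : i ≠ j)
    {s t : Finset (E n)} (hs : s ∈ goodTets T G (U i) r) (ht : t ∈ goodTets T G (U j) r)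
    (hst : s ≠ t) {y : E n} (hy : y ∈ Ω) (hys : y ∈ convexHull ℝ (s : Set (E n)))
    (hyt : y ∈ convexHull ℝ (t : Set (E n)))
    (hskel : ∀ s ∈ tets T, ∀ g : Finset (E n), g ⊆ s → g.card < n →
      y ∉ convexHull ℝ (g : Set (E n))) : False := by
  obtain ⟨hsT, M, hM, hMr⟩ := hs
  obtain ⟨htT, N, hN, hNr⟩ := ht
  obtain ⟨b, hb, hev⟩ := exists_facet_normal hsT htT hst hys hyt (hskel s hsT) (hskel t htT)
  obtain ⟨Q, hQ, h1⟩ := exists_dist_le_of_infDist_well_le hMr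
  obtain ⟨R, hR, h2⟩ := exists_dist_le_of_infDist_well_le hNr
  obtain ⟨τ, hτ, hτb⟩ := exists_orthonormal_tangential hb.1
  have hQ' : star Q * Q = 1 := (Matrix.mem_unitaryGroup_iff'.1
    (Matrix.mem_specialOrthogonalGroup_iff.1 hQ).1)
  have hQs : star Q ∈ Matrix.specialOrthogonalGroup (Fin n) ℝ := by
    rw [Matrix.mem_specialOrthogonalGroup_iff] at hQ ⊢
    exact ⟨Unitary.star_mem hQ.1, by
      rw [Matrix.star_eq_conjTranspose, Matrix.det_conjTranspose, hQ.2, star_one]⟩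
  obtain ⟨l, hl⟩ := hgap i j hij (star Q * R) (mul_mem hQs hR) b hb.1 (hinc b hb) τ hτ hτb
  have hjump := hu.sobolev.tangential_jump hΩ hy hb.1 hM hN hev (hτb l)
  have hrot : Matrix.toEuclideanLin (U i - star Q * R * U j) (τ l)
      = Matrix.toEuclideanLin (star Q * (Q * U i - R * U j)) (τ l) := by
    rw [mul_sub, ← mul_assoc, hQ', one_mul, mul_assoc]
  rw [hrot, norm_toEuclideanLin_rotation hQs] at hl
  have hsplit : Matrix.toEuclideanLin (Q * U i - R * U j) (τ l)
      = Matrix.toEuclideanLin (Q * U i - M) (τ l) + Matrix.toEuclideanLin (N - R * U j) (τ l) := by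
    have : Q * U i - R * U j = (Q * U i - M) + (M - N) + (N - R * U j) := by abel
    rw [this, map_add, map_add, LinearMap.add_apply, LinearMap.add_apply, hjump, add_zero]
  rw [hsplit] at hl
  have h3 := norm_toEuclideanLin_le (Q * U i - M) (τ l)
  have h4 := norm_toEuclideanLin_le (N - R * U j) (τ l)
  rw [hτ.1 l, mul_one, ← dist_eq_norm] at h3 h4
  rw [dist_comm] at h3
  have h5 := norm_add_le (Matrix.toEuclideanLin (Q * U i - M) (τ l))
    (Matrix.toEuclideanLin (N - R * U j) (τ l))
  linarith

/-- Along a segment in `Ω` that avoids the bad tetrahedra and the `(n - 2)`-dimensional skeleton,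
the deformation stays in the same well, since the regions of the wells are closed and disjoint
there. -/
lemma mem_wellRegion_iff_of_segment (hk : 1 ≤ k) {Ω : Set (E n)} {D : Set (Mat n)}
    {u : E n → E n} (hΩ : IsOpen Ω) (hT : IsTriangulation T Ω) (hfin : (tets T).Finite)
    (hu : IsAdmissible Ω T D u G) {d : ℝ} (hsep : WellsSeparated U d) {δ₀ : ℝ}
    (hinc : ∀ b, IsInterfaceNormal T b → IsIncompatibleNormal U δ₀ b) {dbar r : ℝ}
    (hgap : HasTangentialGap U δ₀ dbar) (hr : 2 * r < dbar) (hrd : 2 * r < d) (j : Fin k)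
    {x y : E n} (hseg : segment ℝ x y ⊆ Ω)
    (hbad : ∀ z ∈ segment ℝ x y, z ∉ badRegion T G U r)
    (hskel : ∀ z ∈ segment ℝ x y, ∀ s ∈ tets T, ∀ g : Finset (E n), g ⊆ s → g.card < n →
      z ∉ convexHull ℝ (g : Set (E n))) :
    x ∈ wellRegion T G (U j) r ↔ y ∈ wellRegion T G (U j) r := by
  have hcl : IsClosed (⋃ i ∈ {i | i ≠ j}, wellRegion T G (U i) r) :=
    (Set.toFinite _).isClosed_biUnion fun i _ => (isCompact_wellRegion hfin (U i) r).isClosed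
  have hcover : segment ℝ x y ⊆ wellRegion T G (U j) r ∪
      ⋃ i ∈ {i | i ≠ j}, wellRegion T G (U i) r := by
    intro z hz
    obtain ⟨s, hs, hzs⟩ := Set.mem_iUnion₂.1 (hT.cover (hseg hz))
    rcases bad_or_good (U := U) hk hu r hs with h | ⟨i, hi⟩
    · exact absurd (mem_badRegion.2 ⟨s, h, hzs⟩) (hbad z hz)
    · by_cases hij : i = j
      · exact Or.inl (mem_wellRegion.2 ⟨s, hij ▸ hi, hzs⟩)
      · exact Or.inr (Set.mem_iUnion₂.2 ⟨i, hij, mem_wellRegion.2 ⟨s, hi, hzs⟩⟩)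
  have hdisj : ¬ (segment ℝ x y ∩ (wellRegion T G (U j) r ∩
      ⋃ i ∈ {i | i ≠ j}, wellRegion T G (U i) r)).Nonempty := by
    rintro ⟨z, hz, hzj, hzi⟩
    obtain ⟨i, hij, hzi⟩ := Set.mem_iUnion₂.1 hzi
    obtain ⟨s, hs, hzs⟩ := mem_wellRegion.1 hzj
    obtain ⟨t, ht, hzt⟩ := mem_wellRegion.1 hzi
    have hij : i ≠ j := hij
    by_cases hst : s = t
    · exact not_good_of_good hsep hrd hij.symm hs (hst ▸ ht)
    · exact not_adjacent hΩ hu hinc hgap hr hij.symm hs ht hst (hseg hz) hzs hzt (hskel z hz)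
  have hconn := isPreconnected_closed_iff.1 (convex_segment x y).isPreconnected _ _
    (isCompact_wellRegion hfin (U j) r).isClosed hcl hcover
  have hx := left_mem_segment ℝ x y
  have hy := right_mem_segment ℝ x y
  by_contra hne
  refine hdisj ?_
  by_cases hxj : x ∈ wellRegion T G (U j) r
  · have hyj : y ∉ wellRegion T G (U j) r := fun h => hne ⟨fun _ => h, fun _ => hxj⟩
    exact hconn ⟨x, hx, hxj⟩ ⟨y, hy, (hcover hy).resolve_left hyj⟩
  · have hyj : y ∈ wellRegion T G (U j) r := by
      by_contra h
      exact hne ⟨fun h' => absurd h' hxj, fun h' => absurd h' h⟩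
    exact hconn ⟨y, hy, hyj⟩ ⟨x, hx, (hcover hx).resolve_left hxj⟩

end Regions

/-! ### Translation bounds for the regions -/

section RegionBounds

variable {n k : ℕ}

/-- A translation bound for small translations implies one for all translations, by subdivision of
the segment. -/
lemma hasTranslationBound_of_small {Ω A : Set (E n)} {P : ℝ≥0} {r : ℝ} (hr : 0 < r)
    (h : ∀ v : E n, ‖v‖ ≤ r →
      volume {x | segment ℝ (x - v) x ⊆ Ω ∧ ¬ (x - v ∈ A ↔ x ∈ A)} ≤ P * ‖v‖ₑ) :
    HasTranslationBound Ω A P := by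
  intro v
  obtain ⟨N, hN⟩ := exists_nat_gt (‖v‖ / r)
  have hN0 : (0 : ℝ) < N := lt_of_le_of_lt (by positivity) hN
  let w : E n := (N : ℝ)⁻¹ • v
  have hwv : (N : ℝ) • w = v := by simp only [w]; rw [smul_inv_smul₀ hN0.ne']
  have hwr : ‖w‖ ≤ r := by
    simp only [w]
    rw [norm_smul, norm_inv, Real.norm_of_nonneg hN0.le, inv_mul_le_iff₀ hN0]
    rw [div_lt_iff₀ hr] at hN
    exact hN.le
  let Dw : Set (E n) := {x | segment ℝ (x - w) x ⊆ Ω ∧ ¬ (x - w ∈ A ↔ x ∈ A)}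
  have hsub : {x | segment ℝ (x - v) x ⊆ Ω ∧ ¬ (x - v ∈ A ↔ x ∈ A)}
      ⊆ ⋃ l ∈ Finset.range N, (fun x => x - (l : ℝ) • w) ⁻¹' Dw := by
    rintro x ⟨hseg, hne⟩
    by_contra hx
    simp only [Set.mem_iUnion, not_exists, Finset.mem_range, Set.mem_preimage] at hx
    have hin : ∀ a : ℝ, 0 ≤ a → a ≤ N → x - a • w ∈ segment ℝ (x - v) x := by
      intro a ha haN
      refine ⟨a / N, 1 - a / N, by positivity, ?_, by ring, ?_⟩
      · rw [sub_nonneg, div_le_one hN0]; exact haN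
      · rw [← hwv, smul_sub, smul_smul, div_mul_cancel₀ _ hN0.ne', sub_smul, one_smul]
        abel
    have hstep : ∀ l : ℕ, l ≤ N → (x - (l : ℝ) • w ∈ A ↔ x ∈ A) := by
      intro l
      induction l with
      | zero => intro _; simp
      | succ l ih =>
        intro hl
        rw [← ih (by omega)]
        have h1 := hx l (by omega)
        have h2 : x - (l : ℝ) • w - w = x - ((l + 1 : ℕ) : ℝ) • w := by
          push_cast
          rw [add_smul, one_smul]; abel
        have hl' : ((l + 1 : ℕ) : ℝ) ≤ N := by exact_mod_cast hl
        by_contra hcon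
        refine h1 ⟨?_, ?_⟩
        · rw [h2]
          refine ((convex_segment _ _).segment_subset (hin _ (by positivity) hl')
            (hin _ (by positivity) ?_)).trans hseg
          push_cast at hl'
          linarith
        · rwa [h2]
    refine hne ?_
    have := hstep N le_rfl
    rwa [hwv] at this
  calc volume {x | segment ℝ (x - v) x ⊆ Ω ∧ ¬ (x - v ∈ A ↔ x ∈ A)}
      ≤ ∑ l ∈ Finset.range N, volume ((fun x => x - (l : ℝ) • w) ⁻¹' Dw) :=
        (measure_mono hsub).trans (measure_biUnion_finset_le _ _)
    _ = N * volume Dw := by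
        simp only [sub_eq_add_neg, measure_preimage_add_right]
        rw [Finset.sum_const, Finset.card_range, nsmul_eq_mul]
    _ ≤ N * (P * ‖w‖ₑ) := by gcongr; exact h w hwr
    _ = P * ‖v‖ₑ := by
        have hv : ‖v‖ₑ = N * ‖w‖ₑ := by
          calc ‖v‖ₑ = ‖(N : ℝ) • w‖ₑ := by rw [hwv]
            _ = N * ‖w‖ₑ := by rw [enorm_smul, Real.enorm_natCast]
        rw [hv]
        ring

variable {T : Geometry.SimplicialComplex ℝ (E n)} {G : E n → Mat n} {U : Fin k → Mat n}

/-- The points `x` such that the segment from `x - v` to `x` meets the `(n - 2)`-dimensional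
skeleton. -/
def skeletonShadow (T : Geometry.SimplicialComplex ℝ (E n)) (v : E n) : Set (E n) :=
  ⋃ s ∈ tets T, ⋃ g ∈ {g : Finset (E n) | g ⊆ s ∧ g.card < n},
    {x | (segment ℝ (x - v) x ∩ convexHull ℝ (g : Set (E n))).Nonempty}

lemma volume_skeletonShadow (hfin : (tets T).Finite) (v : E n) :
    volume (skeletonShadow T v) = 0 := by
  classical
  refine (measure_biUnion_null_iff hfin.countable).2 fun s _ => ?_
  have hg : {g : Finset (E n) | g ⊆ s ∧ g.card < n}.Finite :=
    (s.powerset.finite_toSet).subset fun g hg => Finset.mem_coe.2 (Finset.mem_powerset.2 hg.1)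
  exact (measure_biUnion_null_iff hg.countable).2 fun g hg => volume_segment_meets_eq_zero hg.2 v

/-- The union of the intersections of pairs of different tetrahedra. -/
def overlaps (T : Geometry.SimplicialComplex ℝ (E n)) : Set (E n) :=
  ⋃ s ∈ tets T, ⋃ t ∈ {t ∈ tets T | s ≠ t},
    convexHull ℝ (s : Set (E n)) ∩ convexHull ℝ (t : Set (E n))

lemma volume_overlaps (hfin : (tets T).Finite) : volume (overlaps T) = 0 := by
  refine (measure_biUnion_null_iff hfin.countable).2 fun s hs => ?_
  exact (measure_biUnion_null_iff (hfin.subset (Set.sep_subset _ _)).countable).2 fun t ht =>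
    volume_inter_tet_eq_zero hs ht.1 ht.2

lemma mem_overlaps {s t : Finset (E n)} (hs : s ∈ tets T) (ht : t ∈ tets T) (hst : s ≠ t)
    {x : E n} (hxs : x ∈ convexHull ℝ (s : Set (E n))) (hxt : x ∈ convexHull ℝ (t : Set (E n))) :
    x ∈ overlaps T :=
  Set.mem_iUnion₂.2 ⟨s, hs, Set.mem_iUnion₂.2 ⟨t, ⟨ht, hst⟩, hxs, hxt⟩⟩

/-- The union of the shells of thickness `a` around the bad tetrahedra. -/
def badShell (T : Geometry.SimplicialComplex ℝ (E n)) (G : E n → Mat n) (U : Fin k → Mat n)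
    (r a : ℝ) : Set (E n) :=
  ⋃ s ∈ badTets T G U r, shell (convexHull ℝ (s : Set (E n))) a

lemma norm_sub_le_of_mem_segment {x v z : E n} (hz : z ∈ segment ℝ (x - v) x) :
    ‖x - z‖ ≤ ‖v‖ := by
  obtain ⟨a, b, ha, hb, hab, rfl⟩ := hz
  have h1 : x - (a • (x - v) + b • x) = a • v := by
    have : x = (a + b) • x := by rw [hab, one_smul]
    nth_rewrite 1 [this]
    rw [add_smul, smul_sub]; abel
  rw [h1, norm_smul, Real.norm_of_nonneg ha]
  exact mul_le_of_le_one_left (norm_nonneg _) (by linarith)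

lemma mem_badShell_of_enter {r : ℝ} {x v z : E n} (hx : x ∉ badRegion T G U r)
    (hz : z ∈ badRegion T G U r) (hxz : ‖x - z‖ ≤ ‖v‖) : x ∈ badShell T G U r ‖v‖ := by
  obtain ⟨s, hs, hzs⟩ := mem_badRegion.1 hz
  exact Set.mem_iUnion₂.2 ⟨s, hs, fun h => hx (mem_badRegion.2 ⟨s, hs, h⟩), z, hzs, hxz⟩

lemma badRegion_change_subset {Ω : Set (E n)} {r : ℝ} (v : E n) :
    {x | segment ℝ (x - v) x ⊆ Ω ∧ ¬ (x - v ∈ badRegion T G U r ↔ x ∈ badRegion T G U r)}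
      ⊆ badShell T G U r ‖v‖ ∪ (fun x => x - v) ⁻¹' badShell T G U r ‖v‖ := by
  rintro x ⟨-, hne⟩
  by_cases hx : x ∈ badRegion T G U r
  · refine Or.inr (mem_badShell_of_enter (fun h => hne ⟨fun _ => hx, fun _ => h⟩) hx ?_)
    simp
  · have hxv : x - v ∈ badRegion T G U r := by
      by_contra h
      exact hne ⟨fun h' => absurd h' h, fun h' => absurd h' hx⟩
    refine Or.inl (mem_badShell_of_enter hx hxv ?_)
    simp

/-- Up to a null set, the phase `j` changes along a segment only near a bad tetrahedron. -/
lemma wellRegion_change_subset (hk : 1 ≤ k) {Ω : Set (E n)} {D : Set (Mat n)}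
    {u : E n → E n} (hΩ : IsOpen Ω) (hT : IsTriangulation T Ω) (hfin : (tets T).Finite)
    (hu : IsAdmissible Ω T D u G) {d : ℝ} (hsep : WellsSeparated U d) {δ₀ : ℝ}
    (hinc : ∀ b, IsInterfaceNormal T b → IsIncompatibleNormal U δ₀ b) {dbar r : ℝ}
    (hgap : HasTangentialGap U δ₀ dbar) (hr : 2 * r < dbar) (hrd : 2 * r < d) (j : Fin k)
    (v : E n) :
    {x | segment ℝ (x - v) x ⊆ Ω ∧
        ¬ (x - v ∈ wellRegion T G (U j) r ↔ x ∈ wellRegion T G (U j) r)}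
      ⊆ (skeletonShadow T v ∪ (overlaps T ∪ (fun x => x - v) ⁻¹' overlaps T)) ∪
        (badShell T G U r ‖v‖ ∪ (fun x => x - v) ⁻¹' badShell T G U r ‖v‖) := by
  rintro x ⟨hseg, hne⟩
  have hov : ∀ z, z ∈ badRegion T G U r → z ∈ wellRegion T G (U j) r → z ∈ overlaps T := by
    intro z hzb hzw
    obtain ⟨s, hs, hzs⟩ := mem_badRegion.1 hzb
    obtain ⟨t, ht, hzt⟩ := mem_wellRegion.1 hzw
    exact mem_overlaps hs.1 ht.1 (ne_of_bad_of_good hs ht) hzs hzt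
  by_cases hx : x ∈ badRegion T G U r
  · by_cases hxv : x - v ∈ badRegion T G U r
    · -- both end points are bad, and one of them belongs to a good tetrahedron as well
      refine Or.inl (Or.inr ?_)
      by_cases hxj : x ∈ wellRegion T G (U j) r
      · exact Or.inl (hov x hx hxj)
      · refine Or.inr (hov (x - v) hxv ?_)
        by_contra h
        exact hne ⟨fun h' => absurd h' h, fun h' => absurd h' hxj⟩
    · exact Or.inr (Or.inr (mem_badShell_of_enter hxv hx (by simp)))
  · by_cases hsk : x ∈ skeletonShadow T v
    · exact Or.inl (Or.inl hsk)
    · by_cases hb : ∃ z ∈ segment ℝ (x - v) x, z ∈ badRegion T G U r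
      · obtain ⟨z, hz, hzb⟩ := hb
        exact Or.inr (Or.inl (mem_badShell_of_enter hx hzb (norm_sub_le_of_mem_segment hz)))
      · push Not at hb
        refine absurd ?_ hne
        refine mem_wellRegion_iff_of_segment hk hΩ hT hfin hu hsep hinc hgap hr hrd j hseg hb ?_
        intro z hz s hs g hgs hg hzg
        exact hsk (Set.mem_iUnion₂.2 ⟨s, hs, Set.mem_iUnion₂.2 ⟨g, ⟨hgs, hg⟩, z, hz, hzg⟩⟩)

/-- The bad tetrahedra have small total volume, since each of them carries energy. -/
lemma sum_volume_badTets_le {Ω : Set (E n)} {D : Set (Mat n)} {u : E n → E n}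
    (hT : IsTriangulation T Ω) (hu : IsAdmissible Ω T D u G) {r : ℝ} (hr : 0 < r)
    (hfin : (badTets T G U r).Finite) {h : Mat n → ℝ≥0} {c₁ : ℝ} (hc₁ : 0 < c₁)
    (hh : ∀ M ∈ D, c₁ * Metric.infDist M (wells U) ^ 2 ≤ h M) :
    ENNReal.ofReal (c₁ * r ^ 2) * ∑ s ∈ hfin.toFinset, volume (convexHull ℝ (s : Set (E n)))
      ≤ energy Ω h G := by
  have hmem : ∀ s ∈ hfin.toFinset, s ∈ badTets T G U r := fun s hs => hfin.mem_toFinset.1 hs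
  calc ENNReal.ofReal (c₁ * r ^ 2) * ∑ s ∈ hfin.toFinset, volume (convexHull ℝ (s : Set (E n)))
      = ∑ s ∈ hfin.toFinset, ∫⁻ _x in interior (convexHull ℝ (s : Set (E n))),
          ENNReal.ofReal (c₁ * r ^ 2) := by
        rw [Finset.mul_sum]
        refine Finset.sum_congr rfl fun s _ => ?_
        rw [setLIntegral_const, volume_interior_tet]
    _ ≤ ∑ s ∈ hfin.toFinset, ∫⁻ x in interior (convexHull ℝ (s : Set (E n))),
          (h (G x) : ℝ≥0∞) := by
        refine Finset.sum_le_sum fun s hs => lintegral_mono_ae ?_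
        obtain ⟨hsT, M, hM, hMr⟩ := hmem s hs
        obtain ⟨M', hM'D, hM'⟩ := hu.piecewise s hsT
        rw [hM.unique hsT hM'] at hMr
        filter_upwards [ae_restrict_of_ae_restrict_of_subset interior_subset hM'] with x hx
        rw [hx, ← ENNReal.ofReal_coe_nnreal]
        refine ENNReal.ofReal_le_ofReal (le_trans ?_ (hh M' hM'D))
        gcongr
    _ = ∫⁻ x in ⋃ s ∈ hfin.toFinset, interior (convexHull ℝ (s : Set (E n))),
          (h (G x) : ℝ≥0∞) := by
        refine (lintegral_biUnion_finset (fun s hs t ht hst => ?_)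
          (fun s _ => isOpen_interior.measurableSet) _).symm
        exact disjoint_interior_tet (hmem s hs).1 (hmem t ht).1 hst
    _ ≤ energy Ω h G := by
        refine lintegral_mono_set (Set.iUnion₂_subset fun s hs => ?_)
        exact hT.subset s (hmem s hs).1

lemma volume_badShell_le {r : ℝ} (hfin : (badTets T G U r).Finite) {ρ : ℝ} (hρ : 0 < ρ)
    (hball : ∀ s ∈ tets T, ∃ z, Metric.closedBall z ρ ⊆ convexHull ℝ (s : Set (E n)))
    {a : ℝ} (ha : 0 ≤ a) (haρ : a ≤ ρ) :
    volume (badShell T G U r a) ≤ ENNReal.ofReal (2 ^ n * (a / ρ)) *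
      ∑ s ∈ hfin.toFinset, volume (convexHull ℝ (s : Set (E n))) := by
  have hsub : badShell T G U r a
      ⊆ ⋃ s ∈ hfin.toFinset, shell (convexHull ℝ (s : Set (E n))) a := by
    intro x hx
    simpa [badShell] using hx
  refine (measure_mono hsub).trans ((measure_biUnion_finset_le _ _).trans ?_)
  rw [Finset.mul_sum]
  refine Finset.sum_le_sum fun s hs => ?_
  obtain ⟨z, hz⟩ := hball s (hfin.mem_toFinset.1 hs).1
  exact volume_shell_le (convex_convexHull ℝ _) (isCompact_tet s) hρ ha haρ hz

end RegionBounds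

/-! ### Uniform bounds and passage to the limit -/

section Conclusion

variable {n k : ℕ} {T : Geometry.SimplicialComplex ℝ (E n)} {G : E n → Mat n}
  {U : Fin k → Mat n}

/-- The total volume of the bad tetrahedra is of order `1 / m`. -/
lemma sum_volume_badTets_le_div {Ω : Set (E n)} {D : Set (Mat n)} {u : E n → E n}
    (hT : IsTriangulation T Ω) (hu : IsAdmissible Ω T D u G) {r : ℝ} (hr : 0 < r)
    (hfin : (badTets T G U r).Finite) {h : Mat n → ℝ≥0} {c₁ : ℝ} (hc₁ : 0 < c₁)
    (hh : ∀ M ∈ D, c₁ * Metric.infDist M (wells U) ^ 2 ≤ h M) {C : ℝ} {m : ℕ}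
    (hE : energy Ω h G ≤ ENNReal.ofReal (C / m)) :
    ∑ s ∈ hfin.toFinset, volume (convexHull ℝ (s : Set (E n)))
      ≤ ENNReal.ofReal (|C| / (c₁ * r ^ 2) / m) := by
  have hpos : 0 < c₁ * r ^ 2 := by positivity
  have h1 := (sum_volume_badTets_le hT hu hr hfin hc₁ hh).trans hE
  have h2 : ENNReal.ofReal (C / m) ≤ ENNReal.ofReal (|C| / m) := by
    refine ENNReal.ofReal_le_ofReal ?_
    gcongr
    exact le_abs_self C
  rw [mul_comm] at h1
  have h3 := (ENNReal.le_div_iff_mul_le (Or.inl (ENNReal.ofReal_pos.2 hpos).ne')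
    (Or.inl ENNReal.ofReal_ne_top)).2 (h1.trans h2)
  rw [← ENNReal.ofReal_div_of_pos hpos] at h3
  rwa [div_right_comm]

lemma volume_badRegion_le {r : ℝ} (hfin : (badTets T G U r).Finite) :
    volume (badRegion T G U r) ≤ ∑ s ∈ hfin.toFinset, volume (convexHull ℝ (s : Set (E n))) := by
  refine le_trans (measure_mono fun x hx => ?_) (measure_biUnion_finset_le _ _)
  obtain ⟨s, hs, hxs⟩ := mem_badRegion.1 hx
  exact Set.mem_iUnion₂.2 ⟨s, hfin.mem_toFinset.2 hs, hxs⟩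

/-- The translation bounds for all regions. Their constant does not depend on `m`: the shell around
a bad tetrahedron contributes a factor `m`, from the inverse of its in-radius, and the total volume
of the bad tetrahedra a factor `1 / m`. -/
lemma hasTranslationBound_regions (hk : 1 ≤ k) {Ω : Set (E n)} {D : Set (Mat n)}
    {u : E n → E n} (hΩ : IsOpen Ω) (hT : IsTriangulation T Ω) (hfin : (tets T).Finite)
    (hu : IsAdmissible Ω T D u G) {d : ℝ} (hsep : WellsSeparated U d) {δ₀ : ℝ}
    (hinc : ∀ b, IsInterfaceNormal T b → IsIncompatibleNormal U δ₀ b) {dbar r : ℝ}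
    (hgap : HasTangentialGap U δ₀ dbar) (hr0 : 0 < r) (hr : 2 * r < dbar) (hrd : 2 * r < d)
    {c c' : ℝ} {m : ℕ} (hc : 0 < c) (hm : 1 ≤ m) (hnd : IsNondegenerate T c c' m)
    {h : Mat n → ℝ≥0} {c₁ : ℝ} (hc₁ : 0 < c₁)
    (hh : ∀ M ∈ D, c₁ * Metric.infDist M (wells U) ^ 2 ≤ h M) {C : ℝ}
    (hE : energy Ω h G ≤ ENNReal.ofReal (C / m)) :
    (∀ j, HasTranslationBound Ω (wellRegion T G (U j) r)
      (Real.toNNReal (4 * 2 ^ n / c * (|C| / (c₁ * r ^ 2))))) ∧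
    HasTranslationBound Ω (badRegion T G U r)
      (Real.toNNReal (4 * 2 ^ n / c * (|C| / (c₁ * r ^ 2)))) := by
  have hm' : (0 : ℝ) < m := by exact_mod_cast hm
  have hρ : 0 < c / (2 * m) := by positivity
  have hfb : (badTets T G U r).Finite := hfin.subset (Set.sep_subset _ _)
  have hsum := sum_volume_badTets_le_div hT hu hr0 hfb hc₁ hh hE
  have hK : 0 ≤ |C| / (c₁ * r ^ 2) := by positivity
  have hshell : ∀ v : E n, ‖v‖ ≤ c / (2 * m) → volume (badShell T G U r ‖v‖
      ∪ (fun x => x - v) ⁻¹' badShell T G U r ‖v‖)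
      ≤ Real.toNNReal (4 * 2 ^ n / c * (|C| / (c₁ * r ^ 2))) * ‖v‖ₑ := by
    intro v hv
    have h1 := volume_badShell_le hfb hρ (fun s hs => exists_closedBall_subset_tet hc hm hnd hs)
      (norm_nonneg v) hv
    have h2 : volume ((fun x => x - v) ⁻¹' badShell T G U r ‖v‖)
        = volume (badShell T G U r ‖v‖) := by
      simp only [sub_eq_add_neg, measure_preimage_add_right]
    calc _ ≤ volume (badShell T G U r ‖v‖) + volume (badShell T G U r ‖v‖) := by
          refine (measure_union_le _ _).trans ?_
          rw [h2]
      _ ≤ ENNReal.ofReal (2 ^ n * (‖v‖ / (c / (2 * m))))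
            * ENNReal.ofReal (|C| / (c₁ * r ^ 2) / m)
          + ENNReal.ofReal (2 ^ n * (‖v‖ / (c / (2 * m))))
            * ENNReal.ofReal (|C| / (c₁ * r ^ 2) / m) := by
          have h3 := h1.trans (mul_le_mul_right hsum _)
          exact add_le_add h3 h3
      _ = _ := by
          rw [← ofReal_norm, ← ENNReal.ofReal_mul (by positivity),
            ← ENNReal.ofReal_add (by positivity) (by positivity)]
          change _ = ENNReal.ofReal _ * _
          rw [← ENNReal.ofReal_mul (by positivity)]
          congr 1
          field_simp
          ring
  refine ⟨fun j => hasTranslationBound_of_small hρ fun v hv => ?_,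
    hasTranslationBound_of_small hρ fun v hv => ?_⟩
  · refine (measure_mono (wellRegion_change_subset hk hΩ hT hfin hu hsep hinc hgap hr hrd j
      v)).trans ((measure_union_le _ _).trans ?_)
    have hnull : volume (skeletonShadow T v ∪ (overlaps T ∪ (fun x => x - v) ⁻¹' overlaps T))
        = 0 := by
      refine measure_union_null (volume_skeletonShadow hfin v)
        (measure_union_null (volume_overlaps hfin) ?_)
      simp only [sub_eq_add_neg, measure_preimage_add_right]
      exact volume_overlaps hfin
    rw [hnull, zero_add]
    exact hshell v hv
  · exact (measure_mono (badRegion_change_subset v)).trans (hshell v hv)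

/-- Sets that cover `Ω` up to a vanishing part, and converge to sets `B j`: after adding a null set
to the `B j`, they cover `Ω`. -/
lemma exists_covering_limit {Ω : Set (E n)} (hΩ : MeasurableSet Ω)
    {A : Fin k → ℕ → Set (E n)} {R : ℕ → Set (E n)} (hk : 1 ≤ k)
    (hcov : ∀ m, Ω ⊆ R m ∪ ⋃ j, A j m)
    (hR : Tendsto (fun m => volume.restrict Ω (R m)) atTop (𝓝 0)) {B : Fin k → Set (E n)}
    (hBΩ : ∀ j, B j ⊆ Ω) (hB : ∀ j, MeasurableSet (B j))
    (hlim : ∀ j, Tendsto (fun m => volume.restrict Ω (symmDiff (A j m) (B j))) atTop (𝓝 0)) :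
    ∃ B' : Fin k → Set (E n), (∀ j, B' j ⊆ Ω) ∧ (∀ j, MeasurableSet (B' j)) ∧ (⋃ j, B' j) = Ω ∧
      ∀ j, Tendsto (fun m => volume.restrict Ω (symmDiff (A j m) (B' j))) atTop (𝓝 0) := by
  -- the null set to be added
  let N : Set (E n) := Ω \ ⋃ j, B j
  have hN : MeasurableSet N := hΩ.diff (MeasurableSet.iUnion hB)
  have hN0 : volume.restrict Ω N = 0 := by
    have hle : ∀ m, volume.restrict Ω N
        ≤ volume.restrict Ω (R m) + ∑ j, volume.restrict Ω (symmDiff (A j m) (B j)) := by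
      intro m
      have hsub : N ⊆ R m ∪ ⋃ j ∈ Finset.univ, symmDiff (A j m) (B j) := by
        rintro x ⟨hxΩ, hxB⟩
        rcases hcov m hxΩ with h | h
        · exact Or.inl h
        · obtain ⟨j, hj⟩ := Set.mem_iUnion.1 h
          exact Or.inr (Set.mem_iUnion₂.2 ⟨j, Finset.mem_univ j,
            Or.inl ⟨hj, fun h' => hxB (Set.mem_iUnion.2 ⟨j, h'⟩)⟩⟩)
      refine (measure_mono hsub).trans ((measure_union_le _ _).trans ?_)
      gcongr
      exact measure_biUnion_finset_le _ _
    have hlim0 : Tendsto (fun m => volume.restrict Ω (R m)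
        + ∑ j, volume.restrict Ω (symmDiff (A j m) (B j))) atTop (𝓝 0) := by
      have := hR.add (tendsto_finsetSum Finset.univ fun j _ => hlim j)
      simpa using this
    exact le_antisymm (ge_of_tendsto' hlim0 hle) zero_le
  refine ⟨fun j => B j ∪ N, fun j => Set.union_subset (hBΩ j) Set.sdiff_subset,
    fun j => (hB j).union hN, ?_, fun j => ?_⟩
  · refine Set.Subset.antisymm
      (Set.iUnion_subset fun j => Set.union_subset (hBΩ j) Set.sdiff_subset) fun x hx => ?_
    by_cases hxB : x ∈ ⋃ j, B j
    · obtain ⟨j, hj⟩ := Set.mem_iUnion.1 hxB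
      exact Set.mem_iUnion.2 ⟨j, Or.inl hj⟩
    · exact Set.mem_iUnion.2 ⟨⟨0, hk⟩, Or.inr ⟨hx, hxB⟩⟩
  · refine tendsto_of_tendsto_of_tendsto_of_le_of_le tendsto_const_nhds (hlim j)
      (fun _ => zero_le) fun m => ?_
    calc volume.restrict Ω (symmDiff (A j m) (B j ∪ N))
        ≤ volume.restrict Ω (symmDiff (A j m) (B j) ∪ N) := by
          refine measure_mono fun x hx => ?_
          rcases hx with ⟨h1, h2⟩ | ⟨h1 | h1, h2⟩
          · exact Or.inl (Or.inl ⟨h1, fun h => h2 (Or.inl h)⟩)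
          · exact Or.inl (Or.inr ⟨h1, h2⟩)
          · exact Or.inr h1
      _ ≤ volume.restrict Ω (symmDiff (A j m) (B j)) + volume.restrict Ω N :=
          measure_union_le _ _
      _ = volume.restrict Ω (symmDiff (A j m) (B j)) := by rw [hN0, add_zero]

end Conclusion

end SpinArgument

theorem mainTheorem3 {n k : ℕ} (hn : 2 ≤ n) (hk : 1 ≤ k)
    -- the wells
    (U : Fin k → SpinArgument.Mat n) (hU : ∀ j, (U j).PosDef)
    (d : ℝ) (hd : 0 < d) (hsep : SpinArgument.WellsSeparated U d)
    -- the domain and its triangulations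
    (Ω : Set (SpinArgument.E n)) (hΩ : IsOpen Ω) (hΩb : Bornology.IsBounded Ω)
    (T : ℕ → Geometry.SimplicialComplex ℝ (SpinArgument.E n))
    (hT : ∀ m, 1 ≤ m → SpinArgument.IsTriangulation (T m) Ω)
    (c₁T c₂T : ℝ) (hc₁T : 0 < c₁T)
    (hnd : ∀ m, 1 ≤ m → SpinArgument.IsNondegenerate (T m) c₁T c₂T m)
    (δ₀ : ℝ) (hδ₀ : 0 < δ₀)
    (hinc : ∀ m, 1 ≤ m → ∀ b, SpinArgument.IsInterfaceNormal (T m) b →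
      SpinArgument.IsIncompatibleNormal U δ₀ b)
    -- the energy density
    (h : SpinArgument.Mat n → ℝ≥0) (D : Set (SpinArgument.Mat n)) (c₁ : ℝ) (hc₁ : 0 < c₁)
    (hh : ∀ M ∈ D, c₁ * Metric.infDist M (SpinArgument.wells U) ^ 2 ≤ h M)
    -- the deformations `u m`, with weak gradients `G m`
    (u : ℕ → SpinArgument.E n → SpinArgument.E n)
    (G : ℕ → SpinArgument.E n → SpinArgument.Mat n)
    (hu : ∀ m, 1 ≤ m → SpinArgument.IsAdmissible Ω (T m) D (u m) (G m))
    (C : ℝ) (hE : ∀ m, 1 ≤ m → SpinArgument.energy Ω h (G m) ≤ ENNReal.ofReal (C / m)) :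
    (∃ dbar : ℝ, 0 < dbar ∧ SpinArgument.HasTangentialGap U δ₀ dbar) ∧
    ∀ dbar : ℝ, 0 < dbar → SpinArgument.HasTangentialGap U δ₀ dbar →
      ∀ c₀ : ℝ, c₀ = min dbar d →
      -- the perimeters in `Ω` are bounded uniformly in `m`
      (∃ P : ℝ≥0, ∀ m, 1 ≤ m →
        (∀ j, SpinArgument.perimeter Ω
          (SpinArgument.wellRegion (T m) (G m) (U j) (c₀ / 100)) ≤ P) ∧
        SpinArgument.perimeter Ω (SpinArgument.badRegion (T m) (G m) U (c₀ / 100)) ≤ P) ∧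
      -- the bad tetrahedra disappear in the limit
      Tendsto (fun m => eLpNorm
        (SpinArgument.charFun (SpinArgument.badRegion (T m) (G m) U (c₀ / 100)))
        1 (volume.restrict Ω)) atTop (𝓝 0) ∧
      -- compactness
      ∃ (σ : ℕ → ℕ) (A : Fin k → Set (SpinArgument.E n)), StrictMono σ ∧
        (∀ j, SpinArgument.IsCaccioppoli Ω (A j)) ∧ (⋃ j, A j) = Ω ∧
        ∀ j, Tendsto (fun m => eLpNorm
          (SpinArgument.charFun
              (SpinArgument.wellRegion (T (σ m)) (G (σ m)) (U j) (c₀ / 100))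
            - SpinArgument.charFun (A j))
          1 (volume.restrict Ω)) atTop (𝓝 0) := by
  refine ⟨SpinArgument.exists_hasTangentialGap hd hsep hδ₀, fun dbar hdbar hgap c₀ hc₀ => ?_⟩
  have hc₀pos : 0 < c₀ := hc₀ ▸ lt_min hdbar hd
  have hr0 : 0 < c₀ / 100 := by positivity
  have hr : 2 * (c₀ / 100) < dbar := by
    have : c₀ ≤ dbar := hc₀ ▸ min_le_left _ _
    linarith
  have hrd : 2 * (c₀ / 100) < d := by
    have : c₀ ≤ d := hc₀ ▸ min_le_right _ _
    linarith
  have hΩfin : volume Ω ≠ ⊤ := hΩb.measure_lt_top.ne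
  have hfin : ∀ m, 1 ≤ m → (SpinArgument.tets (T m)).Finite := fun m hm =>
    SpinArgument.finite_tets hΩb (hT m hm) hc₁T hm (hnd m hm)
  set P : ℝ≥0 := Real.toNNReal (4 * 2 ^ n / c₁T * (|C| / (c₁ * (c₀ / 100) ^ 2))) with hP
  have hTB := fun m (hm : 1 ≤ m) => SpinArgument.hasTranslationBound_regions hk hΩ (hT m hm)
    (hfin m hm) (hu m hm) hsep (hinc m hm) hgap hr0 hr hrd hc₁T hm (hnd m hm) hc₁ hh (hE m hm)
  have hwell : ∀ m, 1 ≤ m → ∀ j, IsCompact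
      (SpinArgument.wellRegion (T m) (G m) (U j) (c₀ / 100)) := fun m hm j =>
    SpinArgument.isCompact_wellRegion (hfin m hm) _ _
  have hbad : ∀ m, 1 ≤ m → IsCompact
      (SpinArgument.badRegion (T m) (G m) U (c₀ / 100)) := fun m hm =>
    SpinArgument.isCompact_badRegion (hfin m hm) _
  have hper : ∀ m, 1 ≤ m → ∀ j, SpinArgument.perimeter Ω
      (SpinArgument.wellRegion (T m) (G m) (U j) (c₀ / 100)) ≤ n * P := fun m hm j =>
    ((hTB m hm).1 j).perimeter_le hΩ (hwell m hm j).measurableSet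
      (hwell m hm j).measure_lt_top.ne
  have hvol : Tendsto (fun m => volume.restrict Ω
      (SpinArgument.badRegion (T m) (G m) U (c₀ / 100))) atTop (𝓝 0) := by
    have hlim : Tendsto (fun m : ℕ => ENNReal.ofReal (|C| / (c₁ * (c₀ / 100) ^ 2) / m)) atTop
        (𝓝 0) := by
      have := ENNReal.tendsto_ofReal
        (tendsto_const_div_atTop_nhds_zero_nat (|C| / (c₁ * (c₀ / 100) ^ 2)))
      rwa [ENNReal.ofReal_zero] at this
    refine tendsto_of_tendsto_of_tendsto_of_le_of_le' tendsto_const_nhds hlim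
      (Eventually.of_forall fun _ => zero_le) ?_
    filter_upwards [eventually_ge_atTop 1] with m hm
    have hfb := (hfin m hm).subset (Set.sep_subset (SpinArgument.tets (T m)) fun s =>
      ∃ M, SpinArgument.HasGradientOn (G m) s M ∧
        c₀ / 100 < Metric.infDist M (SpinArgument.wells U))
    exact (Measure.restrict_apply_le _ _).trans ((SpinArgument.volume_badRegion_le hfb).trans
      (SpinArgument.sum_volume_badTets_le_div (hT m hm) (hu m hm) hr0 hfb hc₁ hh (hE m hm)))
  refine ⟨⟨n * P, fun m hm => ⟨fun j => ?_, ?_⟩⟩, ?_, ?_⟩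
  · rw [ENNReal.coe_mul, ENNReal.coe_natCast]
    exact hper m hm j
  · rw [ENNReal.coe_mul, ENNReal.coe_natCast]
    exact (hTB m hm).2.perimeter_le hΩ (hbad m hm).measurableSet (hbad m hm).measure_lt_top.ne
  · refine hvol.congr' ?_
    filter_upwards [eventually_ge_atTop 1] with m hm
    have := SpinArgument.eLpNorm_charFun_sub (volume.restrict Ω) (hbad m hm).measurableSet
      MeasurableSet.empty
    rw [← Set.bot_eq_empty, symmDiff_bot] at this
    rw [← this]
    congr 1
    ext x
    simp [SpinArgument.charFun]
  · -- the bounds hold for `m ≥ 1` only, hence the shift by one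
    obtain ⟨σ, hσ, B, hB⟩ := SpinArgument.exists_common_subseq_limit_set hΩ hΩfin
      (A := fun (j : Fin k) m =>
        SpinArgument.wellRegion (T (m + 1)) (G (m + 1)) (U j) (c₀ / 100))
      (fun j m => (hwell (m + 1) (by omega) j).measurableSet)
      (fun j m => (hTB (m + 1) (by omega)).1 j)
    have hσ' : StrictMono fun m => σ m + 1 := fun a b hab => by
      have := hσ hab
      simpa using this
    obtain ⟨B', hB'Ω, hB'm, hB'u, hB'⟩ := SpinArgument.exists_covering_limit hΩ.measurableSet hk
      (A := fun (j : Fin k) m =>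
        SpinArgument.wellRegion (T (σ m + 1)) (G (σ m + 1)) (U j) (c₀ / 100))
      (R := fun m => SpinArgument.badRegion (T (σ m + 1)) (G (σ m + 1)) U (c₀ / 100))
      (fun m x hx => by
        have hm : 1 ≤ σ m + 1 := by omega
        obtain ⟨s, hs, hxs⟩ := Set.mem_iUnion₂.1 ((hT _ hm).cover hx)
        rcases SpinArgument.bad_or_good (U := U) hk (hu _ hm) (c₀ / 100) hs with h | ⟨j, hj⟩
        · exact Or.inl (SpinArgument.mem_badRegion.2 ⟨s, h, hxs⟩)
        · exact Or.inr (Set.mem_iUnion.2 ⟨j, SpinArgument.mem_wellRegion.2 ⟨s, hj, hxs⟩⟩))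
      (hvol.comp hσ'.tendsto_atTop) (fun j => (hB j).1) (fun j => (hB j).2.1)
      (fun j => (hB j).2.2)
    refine ⟨fun m => σ m + 1, B', hσ', fun j => ⟨hB'Ω j, hB'm j, ?_⟩, hB'u, fun j => ?_⟩
    · refine lt_of_le_of_lt (SpinArgument.perimeter_le_of_tendsto hΩfin
        (fun m => (hwell (σ m + 1) (by omega) j).measurableSet) (hB'm j)
        (Eventually.of_forall fun m => hper (σ m + 1) (by omega) j) (hB' j)) ?_
      exact ENNReal.mul_lt_top (ENNReal.natCast_lt_top n) ENNReal.coe_lt_top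
    · refine (hB' j).congr fun m => ?_
      exact (SpinArgument.eLpNorm_charFun_sub _ (hwell (σ m + 1) (by omega) j).measurableSet
        (hB'm j)).symm
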